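/- **Theorem.** Let $d\ge 1$, let $\mathbb B_d=\{z\in\mathbb C^d:\sum_{i=1}^d|z^i|^2<1\}$, and let $\langle z,w\rangle=\sum_{i=1}^d z^i\overline{w^i}$. Let $B^0_d$ be the Hardy space on $\mathbb B_d$, that is, the reproducing kernel Hilbert space of functions on $\mathbb B_d$ with kernel $k_w(z)=(1-\langle z,w\rangle)^{-d}$. A sequence $Z=(z_n)_{n\in\mathbb N}$ in $\mathbb B_d$ is called a *Carleson sequence* for $B^0_d$ if the measure $\mu_Z=\sum_n\|k_{z_n}\|^{-2}\delta_{z_n}$ is a Carleson measure for $B^0_d$, i.e. if there is a constant $C_Z$ with $\|f\|_{L^2(\mathbb B_d,\mu_Z)}\le C_Z\|f\|_{B^0_d}$ for all $f\in B^0_d$. Let $(r_n)_{n\in\mathbb N}$ be a deterministic sequence in $(0,1)$, and let $(\xi_n)_{n\in\mathbb N}$ be independent random variables on a probability space, each uniformly distributed (normalized surface measure) on the unit sphere $\partial\mathbb B_d$. Put $\Lambda=(\lambda_n)_{n\in\mathbb N}$ with $\lambda_n=r_n\xi_n$, and for $m\in\mathbb N=\{0,1,2,\dots\}$ let $$N_m=\#\{n: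 2^{-(m+1)}\le 1-|\lambda_n|<2^{-m}\}=\#\{n: 2^{-(m+1)}\le 1-r_n<2^{-m}\}\in\mathbb N\cup\{\infty\}.$$ If there are $\varepsilon,C>0$ such that $N_m\le C\,2^{d(1-\varepsilon)m}$ for all $m$, then $\Lambda$ is almost surely a Carleson sequence for $B^0_d$. Otherwise, $\Lambda$ is almost surely not a Carleson sequence for $B^0_d$. -/

import Mathlib

open MeasureTheory ProbabilityTheory
open scoped ENNReal NNReal ComplexConjugate

namespace RandomCarleson

/-! ### Carleson measures and Carleson sequences of a reproducing kernel Hilbert space -/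

/-- A measure `μ` on `X` is a Carleson measure for the reproducing kernel Hilbert space `H` of
complex functions on `X` if `H` embeds continuously into `L²(X, μ)`: there is a constant `C` such
that every `f ∈ H` lies in `L²(X, μ)` and `‖f‖_{L²(X, μ)} ≤ C ‖f‖_H`. -/
def IsCarlesonMeasure {X : Type*} [MeasurableSpace X] (H : Type*) [NormedAddCommGroup H]
    [InnerProductSpace ℂ H] [RKHS ℂ H X ℂ] (μ : Measure X) : Prop :=
  ∃ C : ℝ≥0, ∀ f : H,
    AEStronglyMeasurable (fun x => f x) μ ∧ eLpNorm (fun x => f x) 2 μ ≤ C * ‖f‖ₑ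

/-- The measure `μ_Z = ∑ₙ ‖k_{zₙ}‖⁻² δ_{zₙ}` generated by a sequence `Z = (zₙ)`. The reproducing
kernel function `k_z ∈ H` is `RKHS.kerFun H z 1`. -/
noncomputable def sequenceMeasure {X : Type*} [MeasurableSpace X] (H : Type*)
    [NormedAddCommGroup H] [InnerProductSpace ℂ H] [CompleteSpace H] [RKHS ℂ H X ℂ]
    (Z : ℕ → X) : Measure X :=
  Measure.sum fun n => (‖RKHS.kerFun H (Z n) (1 : ℂ)‖ₑ ^ 2)⁻¹ • Measure.dirac (Z n)

/-- A Carleson sequence for `H`: the measure it generates is a Carleson measure for `H`. -/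
def IsCarlesonSequence {X : Type*} [MeasurableSpace X] (H : Type*)
    [NormedAddCommGroup H] [InnerProductSpace ℂ H] [CompleteSpace H] [RKHS ℂ H X ℂ]
    (Z : ℕ → X) : Prop :=
  IsCarlesonMeasure H (sequenceMeasure H Z)

/-! ### The Hardy space on the unit ball -/

/-- The unit ball `{z ∈ ℂᵈ : ∑ |zⁱ|² < 1}`. -/
abbrev UnitBall (d : ℕ) : Type := Metric.ball (0 : EuclideanSpace ℂ (Fin d)) 1

/-- The unit sphere of `ℂᵈ`, the boundary of the unit ball. -/
abbrev UnitSphere (d : ℕ) : Type := Metric.sphere (0 : EuclideanSpace ℂ (Fin d)) 1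

/-- The product `⟨z, w⟩ = ∑ zⁱ conj(wⁱ)` of two points of the ball. -/
noncomputable def ballInner {d : ℕ} (z w : UnitBall d) : ℂ :=
  ∑ i, z.1 i * conj (w.1 i)

/-- The kernel `k_w(z) = (1 - ⟨z, w⟩)^{-d}` of the Hardy space on the unit ball. -/
noncomputable def hardyKernelFun (d : ℕ) (z w : UnitBall d) : ℂ :=
  1 / (1 - ballInner z w) ^ d

/-- The kernel `(1 - ⟨z, w⟩)^{-d}` as an operator-valued kernel on the one-dimensional space `ℂ`
(multiplication by the number `hardyKernelFun d z w`). -/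
noncomputable def hardyKernel (d : ℕ) : Matrix (UnitBall d) (UnitBall d) (ℂ →L[ℂ] ℂ) :=
  Matrix.of fun z w => hardyKernelFun d z w • ContinuousLinearMap.id ℂ ℂ

theorem ballInner_eq_inner {d : ℕ} (z w : UnitBall d) :
    ballInner z w = inner ℂ (w : EuclideanSpace ℂ (Fin d)) z := by
  simp [ballInner, PiLp.inner_apply]

theorem norm_ballInner_lt_one {d : ℕ} (z w : UnitBall d) : ‖ballInner z w‖ < 1 := by
  rw [ballInner_eq_inner]
  have hz : ‖(z : EuclideanSpace ℂ (Fin d))‖ < 1 := mem_ball_zero_iff.1 z.2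
  have hw : ‖(w : EuclideanSpace ℂ (Fin d))‖ < 1 := mem_ball_zero_iff.1 w.2
  refine (norm_inner_le_norm _ _).trans_lt ?_
  nlinarith [norm_nonneg (z : EuclideanSpace ℂ (Fin d)),
    norm_nonneg (w : EuclideanSpace ℂ (Fin d))]

section PosSemidef

open scoped ComplexOrder

theorem posSemidef_rankOne {X : Type*} (a : X → ℂ) :
    (Matrix.of fun z w => a z * conj (a w)).PosSemidef := by
  refine ⟨?_, fun x => ?_⟩
  · ext z w
    simp [Matrix.conjTranspose_apply, mul_comm]
  · have h : (x.sum fun i xi => x.sum fun j xj =>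
        star xi * (Matrix.of fun z w => a z * conj (a w)) i j * xj)
        = star (x.sum fun j xj => conj (a j) * xj) * (x.sum fun j xj => conj (a j) * xj) := by
      simp only [Finsupp.sum, star_sum, Finset.sum_mul_sum]
      refine Finset.sum_congr rfl fun i _ => Finset.sum_congr rfl fun j _ => ?_
      simp
      ring
    rw [h]
    exact star_mul_self_nonneg _

theorem posSemidef_sum {X ι : Type*} (s : Finset ι) (M : ι → X → X → ℂ)
    (h : ∀ i ∈ s, (Matrix.of (M i)).PosSemidef) :
    (Matrix.of fun z w => ∑ i ∈ s, M i z w).PosSemidef := by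
  have := Matrix.posSemidef_sum s h
  convert this using 1
  ext z w
  simp [Matrix.sum_apply]

theorem posSemidef_pow {X : Type*} (M : X → X → ℂ) (h : (Matrix.of M).PosSemidef) (n : ℕ) :
    (Matrix.of fun z w => M z w ^ n).PosSemidef := by
  induction n with
  | zero => simpa using posSemidef_rankOne (fun _ : X => (1 : ℂ))
  | succ n ih =>
    have h2 : (Matrix.of fun z w => M z w ^ (n + 1))
        = (Matrix.of fun z w => M z w ^ n).hadamard (Matrix.of M) := by
      ext z w
      simp [pow_succ]
    rw [h2]
    exact ih.hadamard h

theorem posSemidef_limit {X : Type*} (M : ℕ → X → X → ℂ) (L : X → X → ℂ)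
    (h : ∀ n, (Matrix.of (M n)).PosSemidef)
    (hl : ∀ z w, Filter.Tendsto (fun n => M n z w) Filter.atTop (nhds (L z w))) :
    (Matrix.of L).PosSemidef := by
  refine ⟨?_, fun x => ?_⟩
  · ext z w
    have h1 : Filter.Tendsto (fun n => conj (M n w z)) Filter.atTop (nhds (conj (L w z))) :=
      (Complex.continuous_conj.tendsto _).comp (hl w z)
    refine tendsto_nhds_unique (h1.congr fun n => ?_) (hl z w)
    exact (h n).1.apply z w
  · refine ge_of_tendsto' (x := Filter.atTop) (f := fun n => x.sum fun i xi => x.sum fun j xj =>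
      star xi * Matrix.of (M n) i j * xj) ?_ fun n => (h n).2 x
    refine tendsto_finsetSum _ fun i _ => tendsto_finsetSum _ fun j _ => ?_
    exact ((hl i j).const_mul _).mul_const _

theorem posSemidef_hardyKernelFun (d : ℕ) : (Matrix.of (hardyKernelFun d)).PosSemidef := by
  have h0 : (Matrix.of (ballInner (d := d))).PosSemidef :=
    posSemidef_sum Finset.univ (fun i (z w : UnitBall d) => z.1 i * conj (w.1 i))
      fun i _ => posSemidef_rankOne fun z : UnitBall d => z.1 i
  have h1 : (Matrix.of fun z w : UnitBall d => (1 - ballInner z w)⁻¹).PosSemidef :=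
    posSemidef_limit (fun n z w => ∑ k ∈ Finset.range n, ballInner z w ^ k) _
      (fun n => posSemidef_sum _ (fun k (z w : UnitBall d) => ballInner z w ^ k)
        fun k _ => posSemidef_pow _ h0 k)
      fun z w => (hasSum_geometric_of_norm_lt_one (norm_ballInner_lt_one z w)).tendsto_sum_nat
  have h2 := posSemidef_pow _ h1 d
  convert h2 using 1
  ext z w
  simp [hardyKernelFun]

end PosSemidef

theorem posSemidef_hardyKernel (d : ℕ) : (hardyKernel d).PosSemidef := by
  have hK := posSemidef_hardyKernelFun d
  refine (RKHS.posSemidef_tfae (K := hardyKernel d).out 0 2).2 ?_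
  refine And.intro ?_ fun v => ?_
  · ext z w
    have h := hK.1.apply z w
    simp only [Matrix.of_apply] at h
    have h1 : star (ContinuousLinearMap.id ℂ ℂ) = ContinuousLinearMap.id ℂ ℂ :=
      star_one (ℂ →L[ℂ] ℂ)
    simp [hardyKernel, Matrix.conjTranspose_apply, ← h, h1]
  · have h := (Complex.le_def.1 (hK.2 v)).1
    simp only [Complex.zero_re] at h
    refine h.trans_eq ?_
    simp only [RCLike.re_eq_complex_re]
    congr 1
    refine Finsupp.sum_congr fun i _ => Finsupp.sum_congr fun j _ => ?_
    have h := hK.1.apply i j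
    simp only [Matrix.of_apply] at h
    simp [hardyKernel, ← h]
    ring

instance instFactPosSemidefHardyKernel (d : ℕ) : Fact (hardyKernel d).PosSemidef :=
  ⟨posSemidef_hardyKernel d⟩

/-- The Hardy space `B⁰_d` on the unit ball: the reproducing kernel Hilbert space of functions on
the ball with kernel `k_w(z) = (1 - ⟨z, w⟩)^{-d}`. -/
noncomputable abbrev HardySpace (d : ℕ) : Type := RKHS.OfKernel (hardyKernel d)

/-- The kernel function at `w` of the Hardy space is `z ↦ (1 - ⟨z, w⟩)^{-d}`. -/
theorem kerFun_hardySpace (d : ℕ) (z w : UnitBall d) :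
    RKHS.kerFun (HardySpace d) w (1 : ℂ) z = 1 / (1 - ballInner z w) ^ d := by
  rw [RKHS.kerFun_apply, RKHS.OfKernel.kernel_ofKernel]
  simp [hardyKernel, hardyKernelFun]

/-! ### Random sequences with prescribed radii -/

/-- The uniform distribution on the unit sphere: normalized surface measure. -/
noncomputable def sphereUniform (d : ℕ) : Measure (UnitSphere d) :=
  ((volume : Measure (EuclideanSpace ℂ (Fin d))).toSphere Set.univ)⁻¹ •
    (volume : Measure (EuclideanSpace ℂ (Fin d))).toSphere

/-- The point `r ξ` of the ball with radius `r ∈ (0, 1)` and direction `ξ` on the sphere. -/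
noncomputable def polarPoint {d : ℕ} (r : Set.Ioo (0 : ℝ) 1) (ξ : UnitSphere d) : UnitBall d :=
  ⟨(r : ℝ) • (ξ : EuclideanSpace ℂ (Fin d)), by
    rw [mem_ball_zero_iff, norm_smul, mem_sphere_zero_iff_norm.1 ξ.2, mul_one,
      Real.norm_of_nonneg r.2.1.le]
    exact r.2.2⟩

/-- The number `N_m` (possibly infinite) of points of a sequence with radii `(rₙ)` in the dyadic
shell `{2^{-(m+1)} ≤ 1 - |z| < 2^{-m}}`, counted with multiplicity. -/
noncomputable def shellCount (r : ℕ → Set.Ioo (0 : ℝ) 1) (m : ℕ) : ℕ∞ :=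
  {n : ℕ | ((2 : ℝ) ^ (m + 1))⁻¹ ≤ 1 - (r n : ℝ) ∧ 1 - (r n : ℝ) < ((2 : ℝ) ^ m)⁻¹}.encard

/-- The growth condition: for some `ε, C > 0`, `N_m ≤ C 2^{d(1-ε)m}` for all `m`. -/
def ShellGrowth (d : ℕ) (r : ℕ → Set.Ioo (0 : ℝ) 1) : Prop :=
  ∃ ε C : ℝ, 0 < ε ∧ 0 < C ∧ ∀ m : ℕ,
    (shellCount r m : ℝ≥0∞) ≤ ENNReal.ofReal (C * (2 : ℝ) ^ ((d : ℝ) * (1 - ε) * (m : ℝ)))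

end RandomCarleson

/-!
The weight of a point `z` in the measure of the sequence is `‖k_z‖⁻² = (1 - |z|²) ^ d`, and the
normalized kernel functions have Gram matrix of modulus
`((1 - |zᵢ|²) (1 - |zⱼ|²)) ^ (d / 2) / |1 - ⟨zᵢ, zⱼ⟩| ^ d`. The geometry of the sphere enters only
through the caps `{x : |1 - ⟨x, e⟩| < t}`: their measure is independent of `e` and comparable to
`t ^ d`, and two caps of size `t` that meet have centres at distance less than `4 t`.

Under the growth condition, `∑ (1 - rₙ) ^ s` converges for some `s < d`. By the Schur test
(`isCarlesonSequence_of_schur`), it is enough to bound the row sums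
`∑ⱼ (1 - rᵢ) ^ (d - s) (1 - rⱼ) ^ s / |1 - ⟨zᵢ, zⱼ⟩| ^ d` uniformly in `i`. The terms lie in `[0, 1]`
and, given `ξᵢ`, are independent with expectations that add up to `O((1 - rᵢ) ^ ((d - s) / 2))`. A
Chernoff bound (`exists_measure_row_le`) therefore makes the probability that a row sum exceeds a
large constant `K` smaller than a multiple of `(1 - rᵢ) ^ s`, which is summable, and the Borel-Cantelli
lemma applies. The finitely many remaining rows are dominated by `∑ (1 - rₙ) ^ s`.

If the growth condition fails, then for each `K` some shell `m` has more than a large multiple of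
`2 ^ (d (1 - 1 / K) m)` points. Dividing them into `K` groups and throwing them into about `2 ^ (d m)`
disjoint caps of size comparable to `2 ^ (-m)`, a second moment computation
(`measureReal_no_full_bin_le`) shows that with probability close to one some cap is hit by every
group. Hence almost surely there are clusters of `K` points for every `K`, and testing the embedding
on a kernel function near such a cluster bounds the Carleson constant below by a multiple of `K`
(`card_le_of_cluster`).
-/

namespace RandomCarleson

section Caps

/-! ### Nonisotropic caps on the sphere and their measure -/

open scoped Pointwise

/-- The nonisotropic cap `{x : |1 - ⟨x, e⟩| < t}` on the unit sphere. -/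
def cap {d : ℕ} (e : UnitSphere d) (t : ℝ) : Set (UnitSphere d) :=
  {x | ‖1 - inner ℂ (e : EuclideanSpace ℂ (Fin d)) x‖ < t}

/-- The cone over `cap e t` in the punctured unit ball. -/
def capCone {d : ℕ} (e : EuclideanSpace ℂ (Fin d)) (t : ℝ) : Set (EuclideanSpace ℂ (Fin d)) :=
  {x | 0 < ‖x‖ ∧ ‖x‖ < 1 ∧ ‖((‖x‖ : ℝ) : ℂ) - inner ℂ e x‖ < t * ‖x‖}

variable {d : ℕ}

theorem measurable_norm_one_sub_inner (e : UnitSphere d) :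
    Measurable fun x : UnitSphere d =>
      ‖1 - inner ℂ (e : EuclideanSpace ℂ (Fin d)) (x : EuclideanSpace ℂ (Fin d))‖ := by
  have : Continuous fun x : UnitSphere d =>
      ‖1 - inner ℂ (e : EuclideanSpace ℂ (Fin d)) (x : EuclideanSpace ℂ (Fin d))‖ := by
    fun_prop
  exact this.measurable

theorem measurableSet_cap (e : UnitSphere d) (t : ℝ) : MeasurableSet (cap e t) :=
  measurableSet_lt (measurable_norm_one_sub_inner e) measurable_const

theorem mem_cap_comm {e x : UnitSphere d} {t : ℝ} : x ∈ cap e t ↔ e ∈ cap x t := by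
  simp only [cap, Set.mem_ofPred_eq]
  rw [← inner_conj_symm, ← RCLike.norm_conj, map_sub, map_one, Complex.conj_conj]

theorem norm_sub_sq_le (x y : UnitSphere d) :
    ‖(x : EuclideanSpace ℂ (Fin d)) - y‖ ^ 2 ≤
      2 * ‖1 - inner ℂ (x : EuclideanSpace ℂ (Fin d)) y‖ := by
  have hx : ‖(x : EuclideanSpace ℂ (Fin d))‖ = 1 := mem_sphere_zero_iff_norm.1 x.2
  have hy : ‖(y : EuclideanSpace ℂ (Fin d))‖ = 1 := mem_sphere_zero_iff_norm.1 y.2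
  have h := norm_sub_sq (𝕜 := ℂ) (x : EuclideanSpace ℂ (Fin d)) y
  have h2 := Complex.re_le_norm (1 - inner ℂ (x : EuclideanSpace ℂ (Fin d)) y)
  simp only [Complex.sub_re, Complex.one_re] at h2
  rw [h, hx, hy]
  simp only [RCLike.re_eq_complex_re]
  linarith

/-- The quasi-triangle inequality for `|1 - ⟨x, y⟩|`, a consequence of the identity
`1 - ⟨x, z⟩ = (1 - ⟨x, y⟩) + (1 - ⟨y, z⟩) + ⟨x - y, y - z⟩` for unit vectors. -/
theorem mem_cap_four_mul {e e' x : UnitSphere d} {t : ℝ} (h : x ∈ cap e t) (h' : x ∈ cap e' t) :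
    e' ∈ cap e (4 * t) := by
  have h1 : ‖1 - inner ℂ (e : EuclideanSpace ℂ (Fin d)) x‖ < t := h
  have h2 : ‖1 - inner ℂ (x : EuclideanSpace ℂ (Fin d)) e'‖ < t := mem_cap_comm.1 h'
  have hx : ‖(x : EuclideanSpace ℂ (Fin d))‖ = 1 := mem_sphere_zero_iff_norm.1 x.2
  have a1 := norm_sub_sq_le e x
  have a2 := norm_sub_sq_le x e'
  have key : 1 - inner ℂ (e : EuclideanSpace ℂ (Fin d)) e' =
      (1 - inner ℂ (e : EuclideanSpace ℂ (Fin d)) x) + (1 - inner ℂ (x : EuclideanSpace ℂ (Fin d)) e')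
      + inner ℂ ((e : EuclideanSpace ℂ (Fin d)) - x) ((x : EuclideanSpace ℂ (Fin d)) - e') := by
    have hxx : inner ℂ (x : EuclideanSpace ℂ (Fin d)) (x : EuclideanSpace ℂ (Fin d)) = 1 := by
      rw [inner_self_eq_norm_sq_to_K, hx]; simp
    rw [inner_sub_left, inner_sub_right, inner_sub_right, hxx]
    ring
  have h3 := norm_inner_le_norm (𝕜 := ℂ) ((e : EuclideanSpace ℂ (Fin d)) - x)
    ((x : EuclideanSpace ℂ (Fin d)) - e')
  show ‖1 - inner ℂ (e : EuclideanSpace ℂ (Fin d)) e'‖ < 4 * t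
  rw [key]
  refine (norm_add_le _ _).trans_lt ?_
  have h4 := norm_add_le (1 - inner ℂ (e : EuclideanSpace ℂ (Fin d)) x)
    (1 - inner ℂ (x : EuclideanSpace ℂ (Fin d)) e')
  nlinarith [sq_nonneg (‖(e : EuclideanSpace ℂ (Fin d)) - x‖ - ‖(x : EuclideanSpace ℂ (Fin d)) - e'‖)]

theorem cone_cap (e : UnitSphere d) (t : ℝ) :
    Set.Ioo (0 : ℝ) 1 • (Subtype.val '' cap e t) = capCone (e : EuclideanSpace ℂ (Fin d)) t := by
  ext x
  simp only [Set.mem_smul, Set.mem_image, cap, capCone, Set.mem_ofPred_eq]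
  constructor
  · rintro ⟨ρ, hρ, _, ⟨y, hy, rfl⟩, rfl⟩
    have hy1 : ‖(y : EuclideanSpace ℂ (Fin d))‖ = 1 := mem_sphere_zero_iff_norm.1 y.2
    have hn : ‖ρ • (y : EuclideanSpace ℂ (Fin d))‖ = ρ := by
      rw [norm_smul, hy1, mul_one, Real.norm_of_nonneg hρ.1.le]
    refine ⟨hn.symm ▸ hρ.1, hn.symm ▸ hρ.2, ?_⟩
    rw [hn, inner_smul_right_eq_smul, Complex.real_smul,
      show (ρ : ℂ) - ρ * inner ℂ (e : EuclideanSpace ℂ (Fin d)) y =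
        ρ * (1 - inner ℂ (e : EuclideanSpace ℂ (Fin d)) y) by ring, norm_mul,
      Complex.norm_of_nonneg hρ.1.le, mul_comm t]
    exact mul_lt_mul_of_pos_left hy hρ.1
  · rintro ⟨h0, h1, h2⟩
    have hs : ‖(‖x‖⁻¹ : ℝ) • x‖ = 1 := by
      rw [norm_smul, norm_inv, norm_norm, inv_mul_cancel₀ h0.ne']
    refine ⟨‖x‖, ⟨h0, h1⟩, (‖x‖⁻¹ : ℝ) • x, ⟨⟨_, mem_sphere_zero_iff_norm.2 hs⟩, ?_, rfl⟩, ?_⟩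
    · show ‖1 - inner ℂ (e : EuclideanSpace ℂ (Fin d)) ((‖x‖⁻¹ : ℝ) • x)‖ < t
      rw [← mul_lt_mul_iff_left₀ h0]
      refine lt_of_eq_of_lt ?_ h2
      rw [inner_smul_right_eq_smul, Complex.real_smul]
      have h3 : ((‖x‖ : ℝ) : ℂ) ≠ 0 := by exact_mod_cast h0.ne'
      have h4 : ((‖x‖ : ℝ) : ℂ) - inner ℂ (e : EuclideanSpace ℂ (Fin d)) x =
          (1 - ((‖x‖⁻¹ : ℝ) : ℂ) * inner ℂ (e : EuclideanSpace ℂ (Fin d)) x) * ((‖x‖ : ℝ) : ℂ) := by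
        rw [Complex.ofReal_inv]
        field_simp
      rw [h4, norm_mul, Complex.norm_of_nonneg h0.le]
    · rw [smul_smul, mul_inv_cancel₀ h0.ne', one_smul]

theorem sphereUniform_cap (hd : 1 ≤ d) (e : UnitSphere d) (t : ℝ) :
    sphereUniform d (cap e t) =
      (volume (Metric.ball (0 : EuclideanSpace ℂ (Fin d)) 1))⁻¹ *
        volume (capCone (e : EuclideanSpace ℂ (Fin d)) t) := by
  have : Nonempty (Fin d) := ⟨⟨0, hd⟩⟩
  have hfin : (Module.finrank ℝ (EuclideanSpace ℂ (Fin d)) : ℝ≥0∞) ≠ 0 := by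
    have : 0 < Module.finrank ℝ (EuclideanSpace ℂ (Fin d)) := Module.finrank_pos
    exact_mod_cast this.ne'
  rw [sphereUniform, Measure.smul_apply, Measure.toSphere_apply_univ,
    Measure.toSphere_apply' _ (measurableSet_cap e t), cone_cap, smul_eq_mul,
    ENNReal.mul_inv (Or.inl hfin) (Or.inl (by simp)), mul_mul_mul_comm,
    ENNReal.inv_mul_cancel hfin (by simp), one_mul]

theorem isProbabilityMeasure_sphereUniform (hd : 1 ≤ d) :
    IsProbabilityMeasure (sphereUniform d) := by
  have : Nonempty (Fin d) := ⟨⟨0, hd⟩⟩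
  constructor
  rw [sphereUniform, Measure.smul_apply, smul_eq_mul]
  refine ENNReal.inv_mul_cancel ?_ (measure_ne_top _ _)
  simp only [ne_eq, Measure.measure_univ_eq_zero]
  exact Measure.toSphere_ne_zero _

/-- Unitary invariance: the measure of the cone depends only on the norm of its axis. -/
theorem volume_capCone_eq {e e' : EuclideanSpace ℂ (Fin d)} (he : ‖e‖ = 1) (he' : ‖e'‖ = 1) (t : ℝ) :
    volume (capCone e t) = volume (capCone e' t) := by
  rcases Nat.eq_zero_or_pos d with rfl | hd
  · rw [Subsingleton.elim e e']
  have hb : ∀ v : EuclideanSpace ℂ (Fin d), ‖v‖ = 1 →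
      ∃ b : OrthonormalBasis (Fin d) ℂ (EuclideanSpace ℂ (Fin d)), b ⟨0, hd⟩ = v := by
    intro v hv
    obtain ⟨b, hb⟩ := Orthonormal.exists_orthonormalBasis_extension_of_card_eq (𝕜 := ℂ)
      (E := EuclideanSpace ℂ (Fin d)) (ι := Fin d) (by simp) (v := fun _ => v)
      (s := {⟨0, hd⟩}) (by
        constructor
        · intro i; simpa using hv
        · intro i j hij; exact absurd (Subsingleton.elim i j) hij)
    exact ⟨b, hb _ rfl⟩
  obtain ⟨b, hb1⟩ := hb e he
  obtain ⟨b', hb2⟩ := hb e' he'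
  let U : EuclideanSpace ℂ (Fin d) ≃ₗᵢ[ℂ] EuclideanSpace ℂ (Fin d) := b.equiv b' (Equiv.refl _)
  have hU : U e = e' := by
    rw [← hb1, ← hb2]
    simp [U]
  have hmp : MeasurePreserving U volume volume :=
    LinearIsometryEquiv.measurePreserving
      ({ U with toLinearEquiv := U.toLinearEquiv.restrictScalars ℝ } :
        EuclideanSpace ℂ (Fin d) ≃ₗᵢ[ℝ] EuclideanSpace ℂ (Fin d))
  have hpre : U ⁻¹' capCone e' t = capCone e t := by
    ext x
    simp only [capCone, Set.mem_preimage, Set.mem_ofPred_eq, ← hU, U.inner_map_map, U.norm_map]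
  rw [← hpre]
  exact hmp.measure_preimage_emb U.toHomeomorph.measurableEmbedding _

/-- In coordinates, Lebesgue measure on `ℂᵈ` is a positive finite multiple of product measure. -/
theorem exists_volume_pi (d : ℕ) : ∃ κ : ℝ, 0 < κ ∧ ∀ S : Fin d → Set ℂ,
    (∀ i, MeasurableSet (S i)) →
    volume {x : EuclideanSpace ℂ (Fin d) | ∀ i, x i ∈ S i} =
      ENNReal.ofReal κ * ∏ i, volume (S i) := by
  let L := PiLp.continuousLinearEquiv 2 ℝ (fun _ : Fin d => ℂ)
  have h := Measure.isAddLeftInvariant_eq_smul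
    (Measure.map L (volume : Measure (EuclideanSpace ℂ (Fin d)))) (volume : Measure (Fin d → ℂ))
  refine ⟨_, NNReal.coe_pos.2 (Measure.addHaarScalarFactor_pos_of_isAddHaarMeasure
    (Measure.map L (volume : Measure (EuclideanSpace ℂ (Fin d))))
    (volume : Measure (Fin d → ℂ))), fun S hS => ?_⟩
  have h2 := congrArg (fun μ => μ (Set.univ.pi S)) h
  simp only [Measure.smul_apply, volume_pi_pi] at h2
  rw [ENNReal.ofReal_coe_nnreal]
  refine Eq.trans ?_ h2
  rw [Measure.map_apply L.continuous.measurable (MeasurableSet.univ_pi hS)]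
  congr 1
  ext x
  simp [L]

theorem volume_reProdIm_Icc {a b c e : ℝ} :
    volume (Set.Icc a b ×ℂ Set.Icc c e) = ENNReal.ofReal (b - a) * ENNReal.ofReal (e - c) := by
  have h := Complex.volume_preserving_equiv_real_prod.measure_preimage_equiv
    (Set.Icc a b ×ˢ Set.Icc c e)
  rw [Measure.volume_eq_prod, Measure.prod_prod, Real.volume_Icc, Real.volume_Icc] at h
  rw [← h]
  rfl

theorem measurableSet_reProdIm_Icc {a b c e : ℝ} :
    MeasurableSet (Set.Icc a b ×ℂ Set.Icc c e) :=
  (measurableSet_Icc.preimage Complex.measurable_re).inter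
    (measurableSet_Icc.preimage Complex.measurable_im)

theorem norm_sq_eq_add_sum (k : ℕ) (x : EuclideanSpace ℂ (Fin (k + 1))) :
    ‖x‖ ^ 2 = ‖x 0‖ ^ 2 + ∑ i : Fin k, ‖x i.succ‖ ^ 2 := by
  rw [EuclideanSpace.norm_sq_eq, Fin.sum_univ_succ]

/-- The product of a rectangle in the first coordinate with discs in the other coordinates. -/
def boxSet (k : ℕ) (a b s ρ : ℝ) : Set (EuclideanSpace ℂ (Fin (k + 1))) :=
  {x | ∀ i, x i ∈ (Fin.cons (Set.Icc a b ×ℂ Set.Icc (-s) s)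
    (fun _ => Metric.closedBall (0 : ℂ) ρ) : Fin (k + 1) → Set ℂ) i}

theorem mem_boxSet {k : ℕ} {a b s ρ : ℝ} {x : EuclideanSpace ℂ (Fin (k + 1))} :
    x ∈ boxSet k a b s ρ ↔ (a ≤ (x 0).re ∧ (x 0).re ≤ b ∧ |(x 0).im| ≤ s) ∧
      ∀ i : Fin k, ‖x i.succ‖ ≤ ρ := by
  simp only [boxSet, Set.mem_ofPred_eq, Fin.forall_fin_succ, Fin.cons_zero, Fin.cons_succ,
    mem_closedBall_zero_iff, Complex.mem_reProdIm, Set.mem_Icc, abs_le, and_assoc]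

theorem exists_volume_boxSet (k : ℕ) : ∃ κ : ℝ, 0 < κ ∧ ∀ a b s ρ : ℝ, a ≤ b → 0 ≤ s → 0 ≤ ρ →
    volume (boxSet k a b s ρ) = ENNReal.ofReal (κ * ((b - a) * s * (ρ ^ 2) ^ k)) := by
  obtain ⟨κ, hκ, h⟩ := exists_volume_pi (k + 1)
  refine ⟨κ * 2 * Real.pi ^ k, by positivity, fun a b s ρ hab hs hρ => ?_⟩
  rw [boxSet, h]
  · rw [Fin.prod_univ_succ]
    simp only [Fin.cons_zero, Fin.cons_succ, volume_reProdIm_Icc, Complex.volume_closedBall,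
      Finset.prod_const, Finset.card_univ, Fintype.card_fin]
    have hπ : (NNReal.pi : ℝ≥0∞) = ENNReal.ofReal Real.pi := by
      rw [← NNReal.coe_real_pi, ENNReal.ofReal_coe_nnreal]
    have hba : 0 ≤ b - a := sub_nonneg.2 hab
    rw [hπ, ← ENNReal.ofReal_pow hρ, ← ENNReal.ofReal_mul hba,
      ← ENNReal.ofReal_mul (sq_nonneg ρ), ← ENNReal.ofReal_pow (by positivity),
      ← ENNReal.ofReal_mul (mul_nonneg hba (by linarith)), ← ENNReal.ofReal_mul hκ.le]
    congr 1
    ring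
  · refine Fin.cases ?_ fun i => ?_
    · simpa using measurableSet_reProdIm_Icc
    · simpa using measurableSet_closedBall

theorem inner_single_zero (k : ℕ) (x : EuclideanSpace ℂ (Fin (k + 1))) :
    inner ℂ (EuclideanSpace.single (0 : Fin (k + 1)) (1 : ℂ)) x = x 0 := by
  rw [EuclideanSpace.inner_single_left, map_one, one_mul]

/-- On the cone, `|x|² - |x₀|² ≤ 2 t`, which confines the coordinates other than the first to
discs of radius `√(2 t)`. -/
theorem capCone_subset_boxSet (k : ℕ) {t : ℝ} (ht : 0 < t) :
    capCone (EuclideanSpace.single (0 : Fin (k + 1)) (1 : ℂ)) t ⊆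
      boxSet k (-1) 1 t (√(2 * t)) := by
  rintro x ⟨h0, h1, h2⟩
  rw [inner_single_zero] at h2
  have hsq := norm_sq_eq_add_sum k x
  have hx0 : ‖x 0‖ ≤ ‖x‖ := PiLp.norm_apply_le x 0
  have hre := abs_le.1 ((Complex.abs_re_le_norm (x 0)).trans hx0)
  have him := Complex.abs_im_le_norm (((‖x‖ : ℝ) : ℂ) - x 0)
  simp only [Complex.sub_im, Complex.ofReal_im, zero_sub, abs_neg] at him
  have hlow : ‖x‖ - ‖x 0‖ < t * ‖x‖ := by
    have := norm_sub_norm_le (((‖x‖ : ℝ) : ℂ)) (x 0)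
    rw [Complex.norm_of_nonneg h0.le] at this
    linarith
  refine mem_boxSet.2 ⟨⟨by linarith, by linarith, by nlinarith⟩, fun i => ?_⟩
  refine Real.le_sqrt_of_sq_le ?_
  have hi : ‖x i.succ‖ ^ 2 ≤ ∑ i : Fin k, ‖x i.succ‖ ^ 2 :=
    Finset.single_le_sum (f := fun i : Fin k => ‖x i.succ‖ ^ 2) (fun _ _ => sq_nonneg _)
      (Finset.mem_univ i)
  have hprod : (‖x‖ - ‖x 0‖) * (‖x‖ + ‖x 0‖) ≤ (t * ‖x‖) * (2 * ‖x‖) :=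
    mul_le_mul hlow.le (by linarith) (by positivity) (by positivity)
  have : t * ‖x‖ ^ 2 ≤ t * 1 := by
    have : ‖x‖ ^ 2 ≤ 1 := by nlinarith
    nlinarith
  nlinarith

/-- Conversely, `|x| - Re x₀` is quadratic in `Im x₀` and the other coordinates, so a box of
size `t` in the first and `√t` in each other direction lies in the cone; the constants only need to be
small enough. -/
theorem boxSet_subset_capCone (k : ℕ) {t : ℝ} (ht : 0 < t) (ht1 : t ≤ 1) :
    boxSet k (1 / 4) (1 / 2) (t / 16) (√(t / (64 * (k + 1)))) ⊆
      capCone (EuclideanSpace.single (0 : Fin (k + 1)) (1 : ℂ)) t := by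
  intro x hx
  obtain ⟨⟨h1, h2, h3⟩, h4⟩ := mem_boxSet.1 hx
  have hk : (0 : ℝ) < k + 1 := by positivity
  have hsum : ∑ i : Fin k, ‖x i.succ‖ ^ 2 ≤ t / 64 := by
    calc ∑ i : Fin k, ‖x i.succ‖ ^ 2 ≤ ∑ _i : Fin k, t / (64 * (k + 1)) := by
          refine Finset.sum_le_sum fun i _ => ?_
          rw [← Real.sq_sqrt (show 0 ≤ t / (64 * ((k : ℝ) + 1)) by positivity)]
          exact pow_le_pow_left₀ (norm_nonneg _) (h4 i) 2
      _ = k * (t / (64 * (k + 1))) := by simp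
      _ ≤ t / 64 := by
          rw [← mul_div_assoc, div_le_div_iff₀ (by positivity) (by positivity)]
          nlinarith
  have hsq := norm_sq_eq_add_sum k x
  have hx0 : ‖x 0‖ ^ 2 = (x 0).re ^ 2 + (x 0).im ^ 2 := by
    rw [Complex.sq_norm, Complex.normSq_apply]; ring
  have him2 : (x 0).im ^ 2 ≤ (t / 16) ^ 2 := by
    rw [← sq_abs]; exact pow_le_pow_left₀ (abs_nonneg _) h3 2
  have hre : (x 0).re ≤ ‖x‖ := (Complex.re_le_norm _).trans (PiLp.norm_apply_le x 0)
  have hlt : ‖x‖ < 1 := by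
    have hre2 : (x 0).re ^ 2 ≤ (1 / 2) ^ 2 := pow_le_pow_left₀ (by linarith) h2 2
    have : ‖x‖ ^ 2 < 1 := by nlinarith
    nlinarith [norm_nonneg x]
  refine ⟨by linarith, hlt, ?_⟩
  rw [inner_single_zero]
  have hd : ‖x‖ - (x 0).re ≤ 2 * (t / 64 + (t / 16) ^ 2) := by
    have : (‖x‖ - (x 0).re) * (‖x‖ + (x 0).re) ≤ t / 64 + (t / 16) ^ 2 := by nlinarith
    nlinarith
  have hnorm := Complex.norm_le_abs_re_add_abs_im (((‖x‖ : ℝ) : ℂ) - x 0)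
  simp only [Complex.sub_re, Complex.ofReal_re, Complex.sub_im, Complex.ofReal_im, zero_sub,
    abs_neg] at hnorm
  rw [abs_of_nonneg (by linarith : 0 ≤ ‖x‖ - (x 0).re)] at hnorm
  nlinarith

/-- A cap of size `t` has measure comparable to `t ^ d`: in coordinates with first axis `e`, the
cone over it has extent `1 × t` in the first coordinate and `√t` in each other one. -/
theorem exists_sphereUniform_cap_bounds (hd : 1 ≤ d) : ∃ c C : ℝ, 0 < c ∧ 0 < C ∧
    (∀ (e : UnitSphere d) (t : ℝ), 0 < t → t ≤ 1 →
      ENNReal.ofReal (c * t ^ d) ≤ sphereUniform d (cap e t)) ∧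
    (∀ (e : UnitSphere d) (t : ℝ), 0 < t →
      sphereUniform d (cap e t) ≤ ENNReal.ofReal (C * t ^ d)) := by
  obtain ⟨k, rfl⟩ : ∃ k, d = k + 1 := ⟨d - 1, by omega⟩
  obtain ⟨κ, hκ, hvol⟩ := exists_volume_boxSet k
  have hball0 : (volume (Metric.ball (0 : EuclideanSpace ℂ (Fin (k + 1))) 1)) ≠ 0 :=
    (Metric.measure_ball_pos _ _ one_pos).ne'
  have hballT : (volume (Metric.ball (0 : EuclideanSpace ℂ (Fin (k + 1))) 1)) ≠ ∞ :=
    measure_ball_lt_top.ne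
  set v : ℝ := ((volume (Metric.ball (0 : EuclideanSpace ℂ (Fin (k + 1))) 1))⁻¹).toReal with hv
  have hv0 : 0 < v := ENNReal.toReal_pos (ENNReal.inv_ne_zero.2 hballT) (ENNReal.inv_ne_top.2 hball0)
  have hve : (volume (Metric.ball (0 : EuclideanSpace ℂ (Fin (k + 1))) 1))⁻¹ = ENNReal.ofReal v :=
    (ENNReal.ofReal_toReal (ENNReal.inv_ne_top.2 hball0)).symm
  have he0 : ‖(EuclideanSpace.single (0 : Fin (k + 1)) (1 : ℂ))‖ = 1 := by simp
  refine ⟨v * (κ * (1 / 4 * (1 / 16) * (1 / (64 * (k + 1))) ^ k)), v * (κ * (2 * 2 ^ k)),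
    by positivity, by positivity, fun e t ht ht1 => ?_, fun e t ht => ?_⟩
  · rw [sphereUniform_cap hd, hve, volume_capCone_eq (mem_sphere_zero_iff_norm.1 e.2) he0 t]
    refine le_trans (le_of_eq ?_) (mul_le_mul_right (measure_mono (boxSet_subset_capCone k ht ht1)) _)
    rw [hvol _ _ _ _ (by norm_num) (by positivity) (by positivity), ← ENNReal.ofReal_mul hv0.le,
      Real.sq_sqrt (by positivity), div_eq_mul_one_div t (64 * _), mul_pow]
    congr 1
    ring
  · rw [sphereUniform_cap hd, hve, volume_capCone_eq (mem_sphere_zero_iff_norm.1 e.2) he0 t]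
    refine (mul_le_mul_right (measure_mono (capCone_subset_boxSet k ht)) _).trans (le_of_eq ?_)
    rw [hvol _ _ _ _ (by norm_num) (by positivity) (by positivity), ← ENNReal.ofReal_mul hv0.le,
      Real.sq_sqrt (by positivity), mul_pow]
    congr 1
    ring

theorem sphereUniform_cap_congr (hd : 1 ≤ d) (e e' : UnitSphere d) (t : ℝ) :
    sphereUniform d (cap e t) = sphereUniform d (cap e' t) := by
  rw [sphereUniform_cap hd, sphereUniform_cap hd, volume_capCone_eq
    (mem_sphere_zero_iff_norm.1 e.2) (mem_sphere_zero_iff_norm.1 e'.2)]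

end Caps

section Kernels

/-! ### Carleson sequences and Gram matrices of kernel functions -/

section RKHS

variable {X : Type*} [MeasurableSpace X] [MeasurableSingletonClass X] {H : Type*}
  [NormedAddCommGroup H] [InnerProductSpace ℂ H] [CompleteSpace H] [RKHS ℂ H X ℂ]

theorem eLpNorm_sequenceMeasure_sq (Z : ℕ → X) (f : H) :
    eLpNorm (fun x => f x) 2 (sequenceMeasure H Z) ^ 2 =
      ∑' n, (‖RKHS.kerFun H (Z n) (1 : ℂ)‖ₑ ^ 2)⁻¹ * ‖f (Z n)‖ₑ ^ 2 := by
  have h := eLpNorm_nnreal_pow_eq_lintegral (f := fun x => f x) (μ := sequenceMeasure H Z)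
    (p := 2) (by norm_num)
  simp only [NNReal.coe_ofNat, ENNReal.rpow_ofNat, ENNReal.coe_ofNat] at h
  rw [h, sequenceMeasure, lintegral_sum_measure]
  simp

/-- Being a Carleson sequence is a uniform bound on the finite sums `∑ |f(zₙ)|² / ‖k_{zₙ}‖²`. -/
theorem isCarlesonSequence_iff (Z : ℕ → X) (hZ : ∀ n, RKHS.kerFun H (Z n) (1 : ℂ) ≠ 0) :
    IsCarlesonSequence H Z ↔ ∃ C : ℝ≥0, ∀ (f : H) (s : Finset ℕ),
      ∑ n ∈ s, ‖f (Z n)‖ ^ 2 / ‖RKHS.kerFun H (Z n) (1 : ℂ)‖ ^ 2 ≤ C * ‖f‖ ^ 2 := by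
  have hterm : ∀ (f : H) (n : ℕ), (‖RKHS.kerFun H (Z n) (1 : ℂ)‖ₑ ^ 2)⁻¹ * ‖f (Z n)‖ₑ ^ 2 =
      ENNReal.ofReal (‖f (Z n)‖ ^ 2 / ‖RKHS.kerFun H (Z n) (1 : ℂ)‖ ^ 2) := by
    intro f n
    have hpos : 0 < ‖RKHS.kerFun H (Z n) (1 : ℂ)‖ ^ 2 := pow_pos (norm_pos_iff.2 (hZ n)) 2
    rw [ENNReal.ofReal_div_of_pos hpos, ENNReal.ofReal_pow (norm_nonneg _),
      ENNReal.ofReal_pow (norm_nonneg _), ofReal_norm, ofReal_norm, mul_comm, div_eq_mul_inv]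
  have hiff : ∀ (f : H) (C : ℝ≥0), (∑' n, (‖RKHS.kerFun H (Z n) (1 : ℂ)‖ₑ ^ 2)⁻¹ * ‖f (Z n)‖ₑ ^ 2 ≤
      C * ‖f‖ₑ ^ 2) ↔ ∀ s : Finset ℕ,
      ∑ n ∈ s, ‖f (Z n)‖ ^ 2 / ‖RKHS.kerFun H (Z n) (1 : ℂ)‖ ^ 2 ≤ C * ‖f‖ ^ 2 := by
    intro f C
    have hC : (C : ℝ≥0∞) * ‖f‖ₑ ^ 2 = ENNReal.ofReal (C * ‖f‖ ^ 2) := by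
      rw [ENNReal.ofReal_mul (NNReal.coe_nonneg C), ENNReal.ofReal_coe_nnreal, ENNReal.ofReal_pow (norm_nonneg _),
        ofReal_norm]
    simp only [hterm]
    rw [ENNReal.tsum_eq_iSup_sum, iSup_le_iff]
    refine forall_congr' fun s => ?_
    rw [hC, ← ENNReal.ofReal_sum_of_nonneg (fun _ _ => by positivity),
      ENNReal.ofReal_le_ofReal_iff (by positivity)]
  have hsq : ∀ (f : H) (C : ℝ≥0), eLpNorm (fun x => f x) 2 (sequenceMeasure H Z) ≤ C * ‖f‖ₑ ↔
      ∑' n, (‖RKHS.kerFun H (Z n) (1 : ℂ)‖ₑ ^ 2)⁻¹ * ‖f (Z n)‖ₑ ^ 2 ≤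
      (C ^ 2 : ℝ≥0) * ‖f‖ₑ ^ 2 := by
    intro f C
    rw [← eLpNorm_sequenceMeasure_sq, ENNReal.coe_pow, ← mul_pow]
    exact (ENNReal.pow_right_strictMono two_ne_zero).le_iff_le.symm
  constructor
  · rintro ⟨C, hC⟩
    exact ⟨C ^ 2, fun f => (hiff f _).1 ((hsq f C).1 (hC f).2)⟩
  · rintro ⟨C, hC⟩
    refine ⟨NNReal.sqrt C, fun f => ⟨?_, (hsq f _).2 ?_⟩⟩
    · rw [sequenceMeasure, aestronglyMeasurable_sum_measure_iff]
      exact fun n => aestronglyMeasurable_dirac.smul_measure _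
    · rw [NNReal.sq_sqrt]
      exact (hiff f C).2 (hC f)

end RKHS

/-- A weighted Bessel inequality: if the matrix of absolute values of the Gram matrix of `e` passes
the Schur test with weights `h`, then the analysis operator of `e` is bounded. -/
theorem sum_norm_inner_sq_le_of_schur {H ι : Type*} [NormedAddCommGroup H] [InnerProductSpace ℂ H]
    (e : ι → H) (h : ι → ℝ) (hh : ∀ i, 0 < h i) {C : ℝ} (hC : 0 ≤ C) (s : Finset ι)
    (hS : ∀ i ∈ s, ∑ j ∈ s, ‖inner ℂ (e i) (e j)‖ * h j ≤ C * h i) (f : H) :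
    ∑ i ∈ s, ‖inner ℂ (e i) f‖ ^ 2 ≤ C * ‖f‖ ^ 2 := by
  set c : ι → ℂ := fun i => inner ℂ (e i) f with hc
  set v : H := ∑ i ∈ s, c i • e i with hv
  set S : ℝ := ∑ i ∈ s, ‖c i‖ ^ 2 with hSdef
  have hS0 : 0 ≤ S := Finset.sum_nonneg fun _ _ => sq_nonneg _
  have hvf : inner ℂ v f = (S : ℂ) := by
    rw [hv, sum_inner, hSdef]
    push_cast
    refine Finset.sum_congr rfl fun i _ => ?_
    rw [inner_smul_left, ← Complex.conj_mul']
  have h1 : S ≤ ‖v‖ * ‖f‖ := by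
    have := norm_inner_le_norm (𝕜 := ℂ) v f
    rwa [hvf, Complex.norm_of_nonneg hS0] at this
  have hvv : ‖v‖ ^ 2 ≤ ∑ i ∈ s, ∑ j ∈ s, ‖c i‖ * ‖c j‖ * ‖inner ℂ (e i) (e j)‖ := by
    have : ((‖v‖ ^ 2 : ℝ) : ℂ) = ∑ i ∈ s, ∑ j ∈ s, conj (c i) * c j * inner ℂ (e i) (e j) := by
      push_cast
      have h0 : inner ℂ v v = ((‖v‖ : ℝ) : ℂ) ^ 2 := inner_self_eq_norm_sq_to_K v
      rw [← h0]
      conv_lhs => rw [hv]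
      rw [sum_inner]
      refine Finset.sum_congr rfl fun i _ => ?_
      rw [inner_smul_left, inner_sum, Finset.mul_sum]
      refine Finset.sum_congr rfl fun j _ => ?_
      rw [inner_smul_right, mul_assoc]
    have h2 : ‖v‖ ^ 2 = ‖((‖v‖ ^ 2 : ℝ) : ℂ)‖ := (Complex.norm_of_nonneg (sq_nonneg _)).symm
    rw [h2, this]
    refine (norm_sum_le _ _).trans (Finset.sum_le_sum fun i _ => ?_)
    refine (norm_sum_le _ _).trans (Finset.sum_le_sum fun j _ => ?_)
    rw [norm_mul, norm_mul, RCLike.norm_conj]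
  have hAM : ∀ i j, ‖c i‖ * ‖c j‖ ≤ (‖c i‖ ^ 2 * (h j / h i) + ‖c j‖ ^ 2 * (h i / h j)) / 2 := by
    intro i j
    have hi := hh i
    have hj := hh j
    have e1 : ‖c i‖ ^ 2 * (h j / h i) + ‖c j‖ ^ 2 * (h i / h j) - 2 * (‖c i‖ * ‖c j‖) =
        (‖c i‖ * h j - ‖c j‖ * h i) ^ 2 / (h i * h j) := by
      field_simp
      ring
    have : 0 ≤ (‖c i‖ * h j - ‖c j‖ * h i) ^ 2 / (h i * h j) := by positivity
    linarith
  have hrow : ∑ i ∈ s, ∑ j ∈ s, ‖c i‖ ^ 2 * (h j / h i) * ‖inner ℂ (e i) (e j)‖ ≤ C * S := by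
    rw [hSdef, Finset.mul_sum]
    refine Finset.sum_le_sum fun i hi => ?_
    have h3 : ∑ j ∈ s, ‖c i‖ ^ 2 * (h j / h i) * ‖inner ℂ (e i) (e j)‖ =
        ‖c i‖ ^ 2 / h i * ∑ j ∈ s, ‖inner ℂ (e i) (e j)‖ * h j := by
      rw [Finset.mul_sum]
      refine Finset.sum_congr rfl fun j _ => ?_
      ring
    rw [h3]
    refine (mul_le_mul_of_nonneg_left (hS i hi)
      (div_nonneg (sq_nonneg _) (hh i).le)).trans (le_of_eq ?_)
    have := (hh i).ne'
    field_simp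
  have hcol : ∑ i ∈ s, ∑ j ∈ s, ‖c j‖ ^ 2 * (h i / h j) * ‖inner ℂ (e i) (e j)‖ ≤ C * S := by
    rw [Finset.sum_comm]
    refine le_trans (le_of_eq ?_) hrow
    refine Finset.sum_congr rfl fun i _ => Finset.sum_congr rfl fun j _ => ?_
    rw [norm_inner_symm (e j) (e i)]
  have h4 : ‖v‖ ^ 2 ≤ C * S := by
    refine hvv.trans ?_
    have : ∑ i ∈ s, ∑ j ∈ s, ‖c i‖ * ‖c j‖ * ‖inner ℂ (e i) (e j)‖ ≤
        ∑ i ∈ s, ∑ j ∈ s, (‖c i‖ ^ 2 * (h j / h i) * ‖inner ℂ (e i) (e j)‖ +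
          ‖c j‖ ^ 2 * (h i / h j) * ‖inner ℂ (e i) (e j)‖) / 2 := by
      refine Finset.sum_le_sum fun i _ => Finset.sum_le_sum fun j _ => ?_
      have := mul_le_mul_of_nonneg_right (hAM i j) (norm_nonneg (inner ℂ (e i) (e j)))
      linarith
    refine this.trans ?_
    simp only [← Finset.sum_div, Finset.sum_add_distrib]
    linarith
  by_contra! hlt
  have hSpos : 0 < S := lt_of_le_of_lt (by positivity) hlt
  have h5 : S ^ 2 ≤ (C * S) * ‖f‖ ^ 2 := by
    calc S ^ 2 ≤ (‖v‖ * ‖f‖) ^ 2 := pow_le_pow_left₀ hS0 h1 2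
      _ = ‖v‖ ^ 2 * ‖f‖ ^ 2 := mul_pow _ _ _
      _ ≤ _ := mul_le_mul_of_nonneg_right h4 (sq_nonneg _)
  nlinarith

/-! ### Kernel functions of the Hardy space along polar points -/

variable {d : ℕ}

theorem kerFun_inner_kerFun (z w : UnitBall d) :
    inner ℂ (RKHS.kerFun (HardySpace d) z (1 : ℂ)) (RKHS.kerFun (HardySpace d) w (1 : ℂ)) =
      1 / (1 - ballInner z w) ^ d := by
  rw [RKHS.kerFun_inner, kerFun_hardySpace]
  simp

theorem norm_kerFun_sq (z : UnitBall d) :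
    ‖RKHS.kerFun (HardySpace d) z (1 : ℂ)‖ ^ 2 = 1 / (1 - ‖(z : EuclideanSpace ℂ (Fin d))‖ ^ 2) ^ d := by
  have h := kerFun_inner_kerFun z z
  rw [inner_self_eq_norm_sq_to_K, ballInner_eq_inner, inner_self_eq_norm_sq_to_K] at h
  simp only [Complex.coe_algebraMap] at h
  exact_mod_cast h

theorem one_sub_norm_sq_pos (z : UnitBall d) : 0 < 1 - ‖(z : EuclideanSpace ℂ (Fin d))‖ ^ 2 := by
  have hz : ‖(z : EuclideanSpace ℂ (Fin d))‖ < 1 := mem_ball_zero_iff.1 z.2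
  nlinarith [norm_nonneg (z : EuclideanSpace ℂ (Fin d))]

theorem kerFun_ne_zero (z : UnitBall d) : RKHS.kerFun (HardySpace d) z (1 : ℂ) ≠ 0 := by
  intro h
  have h2 := norm_kerFun_sq z
  rw [h, norm_zero] at h2
  have : 0 < 1 / (1 - ‖(z : EuclideanSpace ℂ (Fin d))‖ ^ 2) ^ d :=
    one_div_pos.2 (pow_pos (one_sub_norm_sq_pos z) d)
  simp only [ne_eq, OfNat.ofNat_ne_zero, not_false_eq_true, zero_pow] at h2
  linarith

theorem norm_polarPoint (ρ : Set.Ioo (0 : ℝ) 1) (x : UnitSphere d) :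
    ‖(polarPoint ρ x : EuclideanSpace ℂ (Fin d))‖ = ρ := by
  show ‖(ρ : ℝ) • (x : EuclideanSpace ℂ (Fin d))‖ = ρ
  rw [norm_smul, mem_sphere_zero_iff_norm.1 x.2, mul_one, Real.norm_of_nonneg ρ.2.1.le]

theorem ballInner_polarPoint (ρ σ : Set.Ioo (0 : ℝ) 1) (x y : UnitSphere d) :
    ballInner (polarPoint ρ x) (polarPoint σ y) =
      ((ρ * σ : ℝ) : ℂ) * inner ℂ (y : EuclideanSpace ℂ (Fin d)) x := by
  rw [ballInner_eq_inner]
  show inner ℂ ((σ : ℝ) • (y : EuclideanSpace ℂ (Fin d))) ((ρ : ℝ) • (x : EuclideanSpace ℂ (Fin d))) = _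
  rw [inner_smul_right_eq_smul, inner_smul_left_eq_smul, Complex.real_smul, Complex.real_smul]
  push_cast
  ring

theorem norm_inner_sphere_le (x y : UnitSphere d) :
    ‖inner ℂ (y : EuclideanSpace ℂ (Fin d)) (x : EuclideanSpace ℂ (Fin d))‖ ≤ 1 := by
  have := norm_inner_le_norm (𝕜 := ℂ) (y : EuclideanSpace ℂ (Fin d)) (x : EuclideanSpace ℂ (Fin d))
  rwa [mem_sphere_zero_iff_norm.1 x.2, mem_sphere_zero_iff_norm.1 y.2, one_mul] at this

/-- The distance function `|1 - ρ⟨x, y⟩|` between points of the ball with directions `x`, `y` and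
product of radii `ρ`. -/
noncomputable def polarDist (ρ : ℝ) (y x : UnitSphere d) : ℝ :=
  ‖1 - (ρ : ℂ) * inner ℂ (y : EuclideanSpace ℂ (Fin d)) x‖

theorem one_sub_le_polarDist {ρ : ℝ} (hρ : 0 ≤ ρ) (y x : UnitSphere d) :
    1 - ρ ≤ polarDist ρ y x := by
  have h := norm_sub_norm_le (1 : ℂ) ((ρ : ℂ) * inner ℂ (y : EuclideanSpace ℂ (Fin d)) x)
  rw [norm_one, norm_mul, Complex.norm_of_nonneg hρ] at h
  have := mul_le_mul_of_nonneg_left (norm_inner_sphere_le x y) hρ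
  unfold polarDist
  linarith

theorem polarDist_le {ρ : ℝ} (hρ : 0 ≤ ρ) (hρ1 : ρ ≤ 1) (y x : UnitSphere d) :
    polarDist ρ y x ≤ (1 - ρ) + ‖1 - inner ℂ (y : EuclideanSpace ℂ (Fin d)) x‖ := by
  have e : 1 - (ρ : ℂ) * inner ℂ (y : EuclideanSpace ℂ (Fin d)) x =
      ((1 - ρ : ℝ) : ℂ) + ρ * (1 - inner ℂ (y : EuclideanSpace ℂ (Fin d)) x) := by
    push_cast; ring
  rw [polarDist, e]
  refine (norm_add_le _ _).trans ?_
  rw [Complex.norm_of_nonneg (by linarith), norm_mul, Complex.norm_of_nonneg hρ]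
  have := mul_le_mul_of_nonneg_right hρ1 (norm_nonneg (1 - inner ℂ (y : EuclideanSpace ℂ (Fin d)) x))
  linarith

theorem norm_one_sub_inner_le {ρ : ℝ} (hρ : 0 ≤ ρ) (hρ1 : ρ ≤ 1) (y x : UnitSphere d) :
    ‖1 - inner ℂ (y : EuclideanSpace ℂ (Fin d)) (x : EuclideanSpace ℂ (Fin d))‖ ≤
      2 * polarDist ρ y x := by
  have e : 1 - inner ℂ (y : EuclideanSpace ℂ (Fin d)) (x : EuclideanSpace ℂ (Fin d)) =
      (1 - (ρ : ℂ) * inner ℂ (y : EuclideanSpace ℂ (Fin d)) x) -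
        ((1 - ρ : ℝ) : ℂ) * inner ℂ (y : EuclideanSpace ℂ (Fin d)) x := by
    push_cast; ring
  have h1 := norm_sub_le (1 - (ρ : ℂ) * inner ℂ (y : EuclideanSpace ℂ (Fin d)) x)
    (((1 - ρ : ℝ) : ℂ) * inner ℂ (y : EuclideanSpace ℂ (Fin d)) x)
  rw [← e, norm_mul, Complex.norm_of_nonneg (by linarith)] at h1
  have h2 := mul_le_mul_of_nonneg_left (norm_inner_sphere_le x y) (by linarith : 0 ≤ 1 - ρ)
  have h3 := one_sub_le_polarDist hρ y x
  unfold polarDist at h3 ⊢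
  linarith

theorem norm_inner_kerFun_polarPoint (ρ σ : Set.Ioo (0 : ℝ) 1) (x y : UnitSphere d) :
    ‖inner ℂ (RKHS.kerFun (HardySpace d) (polarPoint ρ x) (1 : ℂ))
      (RKHS.kerFun (HardySpace d) (polarPoint σ y) (1 : ℂ))‖ = 1 / polarDist (ρ * σ) y x ^ d := by
  rw [kerFun_inner_kerFun, ballInner_polarPoint, norm_div, norm_pow, norm_one]
  rfl

/-- Points clustering at the scale of their distance to the sphere bound the Carleson constant from
below: test the embedding on the kernel function at the point of the same shell over the centre of
the cap. -/
theorem card_le_of_cluster {r : ℕ → Set.Ioo (0 : ℝ) 1} {x : ℕ → UnitSphere d} {C : ℝ≥0}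
    (hC : ∀ (f : HardySpace d) (s : Finset ℕ), ∑ n ∈ s, ‖f (polarPoint (r n) (x n))‖ ^ 2 /
      ‖RKHS.kerFun (HardySpace d) (polarPoint (r n) (x n)) (1 : ℂ)‖ ^ 2 ≤ C * ‖f‖ ^ 2)
    (m : ℕ) (e : UnitSphere d) (s : Finset ℕ)
    (hs : ∀ n ∈ s, ((2 : ℝ) ^ (m + 1))⁻¹ ≤ 1 - (r n : ℝ) ∧ 1 - (r n : ℝ) < ((2 : ℝ) ^ m)⁻¹)
    (hcap : ∀ n ∈ s, x n ∈ cap e ((2 : ℝ) ^ m)⁻¹) :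
    (s.card : ℝ) ≤ C * 36 ^ d := by
  set δ : ℝ := ((2 : ℝ) ^ (m + 1))⁻¹ with hδ
  have hδ0 : 0 < δ := by positivity
  have hδ2 : ((2 : ℝ) ^ m)⁻¹ = 2 * δ := by
    rw [hδ, pow_succ]; field_simp
  have hδ1 : δ < 1 := by
    rw [hδ]
    exact inv_lt_one_of_one_lt₀ (one_lt_pow₀ one_lt_two (by omega))
  -- The radius `1 - δ` puts the test point in the `m`-th shell.
  let ρ : Set.Ioo (0 : ℝ) 1 := ⟨1 - δ, by linarith, by linarith⟩
  have hρ : (ρ : ℝ) = 1 - δ := rfl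
  have h := hC (RKHS.kerFun (HardySpace d) (polarPoint ρ e) (1 : ℂ)) s
  have hw : ‖RKHS.kerFun (HardySpace d) (polarPoint ρ e) (1 : ℂ)‖ ^ 2 ≤ 1 / δ ^ d := by
    rw [norm_kerFun_sq, norm_polarPoint, hρ]
    exact one_div_le_one_div_of_le (by positivity) (pow_le_pow_left₀ hδ0.le (by nlinarith) d)
  have hterm : ∀ n ∈ s, 1 / (36 * δ) ^ d ≤
      ‖RKHS.kerFun (HardySpace d) (polarPoint ρ e) (1 : ℂ) (polarPoint (r n) (x n))‖ ^ 2 /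
      ‖RKHS.kerFun (HardySpace d) (polarPoint (r n) (x n)) (1 : ℂ)‖ ^ 2 := by
    intro n hn
    obtain ⟨h1, h2⟩ := hs n hn
    have h3 : ‖1 - inner ℂ (e : EuclideanSpace ℂ (Fin d)) (x n)‖ < ((2 : ℝ) ^ m)⁻¹ := hcap n hn
    have hr := (r n).2
    rw [hδ2] at h2 h3
    have hk := norm_inner_kerFun_polarPoint (r n) ρ (x n) e
    rw [RKHS.kerFun_inner] at hk
    simp only [RCLike.inner_apply, map_one, mul_one] at hk
    rw [hk, norm_kerFun_sq, norm_polarPoint]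
    have hrρ0 : 0 ≤ (r n : ℝ) * ρ := mul_nonneg hr.1.le ρ.2.1.le
    have hrρ1 : (r n : ℝ) * ρ < 1 := by nlinarith [ρ.2.1, ρ.2.2, hr.1, hr.2]
    have hp := polarDist_le hrρ0 hrρ1.le e (x n)
    have hp0 := one_sub_le_polarDist hrρ0 e (x n)
    have hp6 : polarDist (r n * ρ) e (x n) ≤ 6 * δ := by
      have : 1 - (r n : ℝ) * ρ ≤ 3 * δ := by rw [hρ]; nlinarith [hr.1, hr.2]
      linarith
    have hppos : 0 < polarDist (r n * ρ) e (x n) := by linarith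
    have hq : δ ≤ 1 - (r n : ℝ) ^ 2 := by nlinarith [hr.1, hr.2]
    rw [div_pow, one_pow, div_div_eq_mul_div, div_one, one_div_mul_eq_div]
    calc 1 / (36 * δ) ^ d = δ ^ d / ((6 * δ) ^ d) ^ 2 := by
          rw [mul_pow, mul_pow, mul_pow, ← pow_mul, mul_comm d 2, pow_mul]
          field_simp
          norm_num
      _ ≤ (1 - (r n : ℝ) ^ 2) ^ d / (polarDist (r n * ρ) e (x n) ^ d) ^ 2 := by
          have := pow_le_pow_left₀ hδ0.le hq d
          have := pow_le_pow_left₀ hppos.le hp6 d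
          gcongr
          exact (pow_pos hδ0 d).le.trans ‹_›
  have h5 : (s.card : ℝ) * (1 / (36 * δ) ^ d) ≤ C * (1 / δ ^ d) := by
    rw [← nsmul_eq_mul]
    refine (Finset.card_nsmul_le_sum s _ _ hterm).trans (h.trans ?_)
    exact mul_le_mul_of_nonneg_left hw C.coe_nonneg
  rw [mul_pow] at h5
  have hδd : 0 < δ ^ d := pow_pos hδ0 d
  have h36 : (0 : ℝ) < 36 ^ d := by positivity
  calc (s.card : ℝ) = (s.card : ℝ) * (1 / (36 ^ d * δ ^ d)) * (36 ^ d * δ ^ d) := by field_simp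
    _ ≤ C * (1 / δ ^ d) * (36 ^ d * δ ^ d) := mul_le_mul_of_nonneg_right h5 (by positivity)
    _ = C * 36 ^ d := by field_simp

/-- A sufficient condition for Carleson sequences: the Schur test for the Gram matrix with weights
`(1 - rⱼ) ^ (s - d / 2)`. -/
theorem isCarlesonSequence_of_schur {r : ℕ → Set.Ioo (0 : ℝ) 1} {x : ℕ → UnitSphere d} {s K : ℝ}
    (hK : 0 ≤ K)
    (h : ∀ (i : ℕ) (F : Finset ℕ), ∑ j ∈ F, (1 - (r i : ℝ)) ^ ((d : ℝ) - s) * (1 - (r j : ℝ)) ^ s /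
      polarDist (r i * r j) (x i) (x j) ^ d ≤ K) :
    IsCarlesonSequence (HardySpace d) (fun n => polarPoint (r n) (x n)) := by
  have ha : ∀ n, 0 < 1 - (r n : ℝ) := fun n => by linarith [(r n).2.2]
  set k : ℕ → HardySpace d := fun n => RKHS.kerFun (HardySpace d) (polarPoint (r n) (x n)) (1 : ℂ)
    with hk
  have hk0 : ∀ n, 0 < ‖k n‖ := fun n => norm_pos_iff.2 (kerFun_ne_zero _)
  have hkinv : ∀ n, ‖k n‖⁻¹ ≤ (2 * (1 - (r n : ℝ))) ^ ((d : ℝ) / 2) := by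
    intro n
    have h2 : (‖k n‖⁻¹) ^ 2 ≤ ((2 * (1 - (r n : ℝ))) ^ ((d : ℝ) / 2)) ^ 2 := by
      rw [inv_pow, hk]
      simp only
      rw [norm_kerFun_sq, norm_polarPoint, one_div, inv_inv, ← Real.rpow_natCast (_ ^ ((d : ℝ) / 2)),
        ← Real.rpow_mul (by linarith [ha n])]
      simp only [Nat.cast_ofNat, div_mul_cancel₀ _ (two_ne_zero' ℝ), Real.rpow_natCast]
      refine pow_le_pow_left₀ ?_ ?_ d
      · nlinarith [(r n).2.1, (r n).2.2]
      · nlinarith [(r n).2.1, (r n).2.2]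
    exact le_of_sq_le_sq h2 (Real.rpow_nonneg (by linarith [ha n]) _)
  rw [isCarlesonSequence_iff _ fun n => kerFun_ne_zero _]
  refine ⟨⟨2 ^ d * K, by positivity⟩, fun f F => ?_⟩
  have hsch := sum_norm_inner_sq_le_of_schur (fun n => ((‖k n‖⁻¹ : ℝ) : ℂ) • k n)
    (fun n => (1 - (r n : ℝ)) ^ (s - (d : ℝ) / 2)) (fun n => Real.rpow_pos_of_pos (ha n) _)
    (C := 2 ^ d * K) (by positivity) F ?_ f
  · refine le_trans (le_of_eq ?_) hsch
    refine Finset.sum_congr rfl fun n _ => ?_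
    rw [inner_smul_left, norm_mul, RCLike.norm_conj, Complex.norm_of_nonneg (inv_nonneg.2 (hk0 n).le),
      hk]
    simp only
    rw [RKHS.kerFun_inner]
    simp only [RCLike.inner_apply, map_one, mul_one]
    rw [mul_pow, inv_pow, div_eq_mul_inv, mul_comm]
  · intro i _
    set A : ℝ := (1 - (r i : ℝ)) with hA
    have hA0 : 0 < A := ha i
    calc ∑ j ∈ F, ‖inner ℂ (((‖k i‖⁻¹ : ℝ) : ℂ) • k i) (((‖k j‖⁻¹ : ℝ) : ℂ) • k j)‖ *
          (1 - (r j : ℝ)) ^ (s - (d : ℝ) / 2)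
        ≤ ∑ j ∈ F, 2 ^ d * A ^ (s - (d : ℝ) / 2) *
          (A ^ ((d : ℝ) - s) * (1 - (r j : ℝ)) ^ s / polarDist (r i * r j) (x i) (x j) ^ d) := by
          refine Finset.sum_le_sum fun j _ => ?_
          have hB0 : 0 < 1 - (r j : ℝ) := ha j
          set B : ℝ := 1 - (r j : ℝ) with hB
          have hin : ‖inner ℂ (k i) (k j)‖ = 1 / polarDist (r i * r j) (x i) (x j) ^ d := by
            rw [norm_inner_symm, hk]
            simp only
            rw [norm_inner_kerFun_polarPoint, mul_comm (r j : ℝ)]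
          have hP : 0 ≤ polarDist (r i * r j) (x i) (x j) := norm_nonneg _
          rw [inner_smul_left, inner_smul_right, norm_mul, norm_mul, RCLike.norm_conj,
            Complex.norm_of_nonneg (inv_nonneg.2 (hk0 i).le),
            Complex.norm_of_nonneg (inv_nonneg.2 (hk0 j).le), hin]
          have e1 : (2 * A) ^ ((d : ℝ) / 2) * (2 * B) ^ ((d : ℝ) / 2) * B ^ (s - (d : ℝ) / 2) =
              2 ^ d * A ^ (s - (d : ℝ) / 2) * (A ^ ((d : ℝ) - s) * B ^ s) := by
            rw [Real.mul_rpow two_pos.le hA0.le, Real.mul_rpow two_pos.le hB0.le]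
            have e2 : (2 : ℝ) ^ ((d : ℝ) / 2) * 2 ^ ((d : ℝ) / 2) = 2 ^ d := by
              rw [← Real.rpow_add two_pos, add_halves, Real.rpow_natCast]
            have e3 : B ^ ((d : ℝ) / 2) * B ^ (s - (d : ℝ) / 2) = B ^ s := by
              rw [← Real.rpow_add hB0]; congr 1; ring
            have e4 : A ^ (s - (d : ℝ) / 2) * A ^ ((d : ℝ) - s) = A ^ ((d : ℝ) / 2) := by
              rw [← Real.rpow_add hA0]; congr 1; ring
            rw [← e2, ← e3, ← e4]
            ring
          have e5 : ‖k i‖⁻¹ * ‖k j‖⁻¹ * B ^ (s - (d : ℝ) / 2) ≤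
              2 ^ d * A ^ (s - (d : ℝ) / 2) * (A ^ ((d : ℝ) - s) * B ^ s) := by
            rw [← e1]
            have := hkinv i
            have := hkinv j
            have := (hk0 i).le
            gcongr
          have e6 := mul_le_mul_of_nonneg_right e5
            (show 0 ≤ 1 / polarDist (r i * r j) (x i) (x j) ^ d by positivity)
          refine le_trans (le_of_eq ?_) (e6.trans (le_of_eq ?_)) <;> ring
      _ ≤ 2 ^ d * A ^ (s - (d : ℝ) / 2) * K := by
          rw [← Finset.mul_sum]
          exact mul_le_mul_of_nonneg_left (h i F) (by positivity)
      _ = 2 ^ d * K * A ^ (s - (d : ℝ) / 2) := by ring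

end Kernels

section Bins

/-! ### Full bins: a second moment bound -/

section Bins

/-- Chebyshev's inequality for a sum of indicators of pairwise nonpositively correlated events of
equal probability. -/
theorem measureReal_iInter_compl_le {α β : Type*} [MeasurableSpace α] (μ : Measure α)
    [IsProbabilityMeasure μ] (T : Finset β) (hT : T.Nonempty) (E : β → Set α)
    (hE : ∀ b, MeasurableSet (E b)) {θ : ℝ} (hθ : 0 < θ) (h1 : ∀ b ∈ T, μ.real (E b) = θ)
    (h2 : ∀ b ∈ T, ∀ b' ∈ T, b ≠ b' → μ.real (E b ∩ E b') ≤ θ ^ 2) :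
    μ.real {ω | ∀ b ∈ T, ω ∉ E b} ≤ 1 / (T.card * θ) := by
  classical
  set M : ℝ := (T.card : ℝ) with hM
  have hM0 : 0 < M := by rw [hM]; exact_mod_cast hT.card_pos
  set g : β → α → ℝ := fun b => (E b).indicator 1 with hg
  have hgint : ∀ b, Integrable (g b) μ := fun b =>
    (integrable_const (1 : ℝ)).indicator (hE b)
  have hgg : ∀ b b', (fun ω => g b ω * g b' ω) = (E b ∩ E b').indicator 1 := by
    intro b b'
    ext ω
    simp only [hg, Set.indicator_apply, Pi.one_apply, Set.mem_inter_iff]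
    split_ifs <;> simp_all
  have hprod : ∀ b b', (fun ω => (g b ω - θ) * (g b' ω - θ)) =
      fun ω => (E b ∩ E b').indicator 1 ω - θ * g b ω - θ * g b' ω + θ ^ 2 := by
    intro b b'
    ext ω
    have := congrFun (hgg b b') ω
    rw [← this]; ring
  have hi1 : ∀ b b', Integrable ((E b ∩ E b').indicator (1 : α → ℝ)) μ := fun b b' =>
    (integrable_const (1 : ℝ)).indicator ((hE b).inter (hE b'))
  have hint : ∀ b b', Integrable (fun ω => (g b ω - θ) * (g b' ω - θ)) μ := by
    intro b b'
    rw [hprod]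
    exact (((hi1 b b').sub ((hgint b).const_mul θ)).sub ((hgint b').const_mul θ)).add
      (integrable_const _)
  have hval : ∀ b ∈ T, ∀ b' ∈ T, ∫ ω, (g b ω - θ) * (g b' ω - θ) ∂μ =
      μ.real (E b ∩ E b') - θ ^ 2 := by
    intro b hb b' hb'
    have i1 : Integrable (fun ω => (E b ∩ E b').indicator (1 : α → ℝ) ω) μ := hi1 b b'
    have i2 : Integrable (fun ω => θ * g b ω) μ := (hgint b).const_mul θ
    have i3 : Integrable (fun ω => θ * g b' ω) μ := (hgint b').const_mul θ
    have i4 : Integrable (fun ω => (E b ∩ E b').indicator (1 : α → ℝ) ω - θ * g b ω) μ := i1.sub i2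
    have i5 : Integrable (fun ω => (E b ∩ E b').indicator (1 : α → ℝ) ω - θ * g b ω - θ * g b' ω) μ :=
      i4.sub i3
    have e1 : ∫ ω, g b ω ∂μ = θ := (integral_indicator_one (hE b)).trans (h1 b hb)
    have e2 : ∫ ω, g b' ω ∂μ = θ := (integral_indicator_one (hE b')).trans (h1 b' hb')
    rw [hprod, integral_add i5 (integrable_const _), integral_sub i4 i3, integral_sub i1 i2,
      integral_const_mul, integral_const_mul, e1, e2,
      integral_indicator_one ((hE b).inter (hE b'))]
    simp
    ring
  have hvar : ∫ ω, (∑ b ∈ T, (g b ω - θ)) ^ 2 ∂μ ≤ M * θ := by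
    have : ∀ ω, (∑ b ∈ T, (g b ω - θ)) ^ 2 = ∑ b ∈ T, ∑ b' ∈ T, (g b ω - θ) * (g b' ω - θ) := by
      intro ω
      rw [sq, Finset.sum_mul_sum]
    simp only [this]
    rw [integral_finsetSum _ fun b _ => integrable_finsetSum _ fun b' _ => hint b b']
    have : ∀ b ∈ T, ∫ ω, ∑ b' ∈ T, (g b ω - θ) * (g b' ω - θ) ∂μ ≤ θ := by
      intro b hb
      rw [integral_finsetSum _ fun b' _ => hint b b', ← Finset.add_sum_erase _ _ hb]
      have h3 : ∑ b' ∈ T.erase b, ∫ ω, (g b ω - θ) * (g b' ω - θ) ∂μ ≤ 0 := by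
        refine Finset.sum_nonpos fun b' hb' => ?_
        rw [hval b hb b' (Finset.mem_of_mem_erase hb')]
        linarith [h2 b hb b' (Finset.mem_of_mem_erase hb') (Finset.ne_of_mem_erase hb').symm]
      rw [hval b hb b hb, Set.inter_self, h1 b hb]
      nlinarith [sq_nonneg θ]
    refine (Finset.sum_le_sum this).trans (le_of_eq ?_)
    rw [Finset.sum_const, nsmul_eq_mul]
  have hmarkov := mul_meas_ge_le_integral_of_nonneg (μ := μ)
    (f := fun ω => (∑ b ∈ T, (g b ω - θ)) ^ 2) (ae_of_all _ fun ω => sq_nonneg _) (by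
      have : (fun ω => (∑ b ∈ T, (g b ω - θ)) ^ 2) =
          fun ω => ∑ b ∈ T, ∑ b' ∈ T, (g b ω - θ) * (g b' ω - θ) := by
        ext ω
        rw [sq, Finset.sum_mul_sum]
      rw [this]
      exact integrable_finsetSum _ fun b _ => integrable_finsetSum _ fun b' _ => hint b b')
    ((M * θ) ^ 2)
  have hsub : {ω | ∀ b ∈ T, ω ∉ E b} ⊆ {ω | (M * θ) ^ 2 ≤ (∑ b ∈ T, (g b ω - θ)) ^ 2} := by
    intro ω hω
    have : ∑ b ∈ T, (g b ω - θ) = - (M * θ) := by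
      rw [Finset.sum_congr rfl (g := fun _ => - θ)]
      · simp [hM]
      · intro b hb
        simp [hg, Set.indicator_of_notMem (hω b hb)]
    simp only [Set.mem_ofPred_eq]
    rw [this, neg_sq]
  have h4 : (M * θ) ^ 2 * μ.real {ω | ∀ b ∈ T, ω ∉ E b} ≤ M * θ := by
    refine le_trans ?_ (hmarkov.trans hvar)
    exact mul_le_mul_of_nonneg_left (measureReal_mono hsub) (sq_nonneg _)
  rw [le_div_iff₀ (by positivity)]
  have hMθ : 0 < M * θ := by positivity
  nlinarith

/-- Independent identically distributed variables indexed by `κ × ι` split into independent groups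
indexed by `κ`, each with the product law. -/
theorem map_curry_eq_pi {Ω S κ ι : Type*} [MeasurableSpace Ω] {P : Measure Ω}
    [IsProbabilityMeasure P] [MeasurableSpace S] [Fintype κ] [Fintype ι] {Y : κ × ι → Ω → S}
    (hY : ∀ a, Measurable (Y a)) (hind : iIndepFun Y P) {ν : Measure S} [IsProbabilityMeasure ν]
    (hlaw : ∀ a, P.map (Y a) = ν) :
    P.map (fun ω (k : κ) (i : ι) => Y (k, i) ω) =
      Measure.pi fun _ : κ => Measure.pi fun _ : ι => ν := by
  have hcanon := iIndepFun_uncurry_infinitePi' (ι := κ) (κ := ι) (X := fun _ _ x => x)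
    (fun _ _ => ν) (fun _ _ => measurable_id)
  simp only [Measure.infinitePi_eq_pi] at hcanon
  set L : Measure (κ → ι → S) := Measure.pi fun _ : κ => Measure.pi fun _ : ι => ν with hL
  have h1 := hind.map_fun_eq_pi_map fun a => (hY a).aemeasurable
  have hev : ∀ a : κ × ι, Measurable fun ω : κ → ι → S => ω a.1 a.2 := fun a => by fun_prop
  have h2 := hcanon.map_fun_eq_pi_map fun a => (hev a).aemeasurable
  have h3 : ∀ a : κ × ι, L.map (fun ω => ω a.1 a.2) = ν := by
    intro a
    have e : (fun ω : κ → ι → S => ω a.1 a.2) = (fun f : ι → S => f a.2) ∘ fun ω => ω a.1 := rfl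
    rw [e, ← Measure.map_map (by fun_prop) (by fun_prop), hL,
      (measurePreserving_eval (fun _ : κ => Measure.pi fun _ : ι => ν) a.1).map_eq,
      (measurePreserving_eval (fun _ : ι => ν) a.2).map_eq]
  simp only [hlaw] at h1
  simp only [h3] at h2
  have h4 := congrArg (Measure.map fun (f : κ × ι → S) (k : κ) (i : ι) => f (k, i)) (h1.trans h2.symm)
  rw [Measure.map_map (by fun_prop) (by fun_prop), Measure.map_map (by fun_prop) (by fun_prop)] at h4
  refine h4.trans ?_
  exact Measure.map_id

/-- Balls and bins: if each of the groups `k` throws `n` independent balls, and the disjoint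
bins `B b` all have probability `p`, then with high probability some bin is hit by every group. -/
theorem measureReal_no_full_bin_le {Ω S κ ι β : Type*} [MeasurableSpace Ω] {P : Measure Ω}
    [IsProbabilityMeasure P] [MeasurableSpace S] [Fintype κ] [Fintype ι] {Y : κ × ι → Ω → S}
    (hY : ∀ a, Measurable (Y a)) (hind : iIndepFun Y P) {ν : Measure S} [IsProbabilityMeasure ν]
    (hlaw : ∀ a, P.map (Y a) = ν) (B : β → Set S) (hB : ∀ b, MeasurableSet (B b)) (T : Finset β)
    (hT : T.Nonempty) (hdisj : ∀ b ∈ T, ∀ b' ∈ T, b ≠ b' → Disjoint (B b) (B b')) {p : ℝ}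
    (hp : ∀ b ∈ T, ν.real (B b) = p) (hq : 0 < 1 - (1 - p) ^ Fintype.card ι) :
    P.real {ω | ∀ b ∈ T, ∃ k, ∀ i, Y (k, i) ω ∉ B b} ≤
      1 / (T.card * (1 - (1 - p) ^ Fintype.card ι) ^ Fintype.card κ) := by
  set n := Fintype.card ι with hn
  set q : ℝ := 1 - (1 - p) ^ n with hqdef
  set L0 : Measure (ι → S) := Measure.pi fun _ : ι => ν with hL0
  set L : Measure (κ → ι → S) := Measure.pi fun _ : κ => L0 with hL
  set G : β → Set (ι → S) := fun b => {f | ∃ i, f i ∈ B b} with hG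
  have hGc : ∀ b, (G b)ᶜ = Set.univ.pi fun _ : ι => (B b)ᶜ := by
    intro b; ext f; simp [hG]
  have hGmeas : ∀ b, MeasurableSet (G b) := by
    intro b
    rw [← MeasurableSet.compl_iff, hGc]
    exact MeasurableSet.univ_pi fun _ => (hB b).compl
  have hpi : ∀ A : Set S, L0.real (Set.univ.pi fun _ : ι => A) = ν.real A ^ n := by
    intro A
    rw [measureReal_def, hL0, Measure.pi_pi, ENNReal.toReal_prod]
    simp [measureReal_def, hn]
  have hGcm : ∀ b ∈ T, L0.real (G b)ᶜ = (1 - p) ^ n := by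
    intro b hb
    rw [hGc, hpi, probReal_compl_eq_one_sub (hB b), hp b hb]
  have hGm : ∀ b ∈ T, L0.real (G b) = q := by
    intro b hb
    have := probReal_compl_eq_one_sub (μ := L0) (hGmeas b)
    rw [hGcm b hb] at this
    rw [hqdef]; linarith
  have hGG : ∀ b ∈ T, ∀ b' ∈ T, b ≠ b' → L0.real (G b ∩ G b') ≤ q ^ 2 := by
    intro b hb b' hb' hne
    have e1 := probReal_compl_eq_one_sub (μ := L0) ((hGmeas b).inter (hGmeas b'))
    rw [Set.compl_inter] at e1
    have e2 := measureReal_union_add_inter (μ := L0) (s := (G b)ᶜ) (hGmeas b').compl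
    have e3 : L0.real ((G b)ᶜ ∩ (G b')ᶜ) = (1 - 2 * p) ^ n := by
      have : (G b)ᶜ ∩ (G b')ᶜ = Set.univ.pi fun _ : ι => (B b ∪ B b')ᶜ := by
        rw [hGc, hGc, ← Set.pi_inter_distrib, Set.compl_union]
      rw [this, hpi, probReal_compl_eq_one_sub ((hB b).union (hB b')),
        measureReal_union (hdisj b hb b' hb' hne) (hB b'), hp b hb, hp b' hb']
      ring
    rw [e3, hGcm b hb, hGcm b' hb'] at e2
    have hle : (1 - 2 * p) ^ n ≤ ((1 - p) ^ 2) ^ n := by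
      refine pow_le_pow_left₀ ?_ (by nlinarith [sq_nonneg p]) n
      have h5 : ν.real (B b ∪ B b') ≤ 1 := measureReal_le_one
      rw [measureReal_union (hdisj b hb b' hb' hne) (hB b'), hp b hb, hp b' hb'] at h5
      linarith
    rw [← pow_mul, mul_comm 2 n, pow_mul] at hle
    rw [hqdef]
    nlinarith
  have hpiL : ∀ A : Set (ι → S), L.real (Set.univ.pi fun _ : κ => A) = L0.real A ^ Fintype.card κ := by
    intro A
    rw [measureReal_def, hL, Measure.pi_pi, ENNReal.toReal_prod]
    simp [measureReal_def]
  set E : β → Set (κ → ι → S) := fun b => Set.univ.pi fun _ : κ => G b with hE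
  have hEmeas : ∀ b, MeasurableSet (E b) := fun b => MeasurableSet.univ_pi fun _ => hGmeas b
  have key := measureReal_iInter_compl_le L T hT E hEmeas (θ := q ^ Fintype.card κ)
    (pow_pos hq _) (fun b hb => by rw [hE]; simp only; rw [hpiL, hGm b hb]) (by
      intro b hb b' hb' hne
      rw [hE]; simp only
      rw [← Set.pi_inter_distrib, hpiL, ← pow_mul, mul_comm _ 2, pow_mul]
      exact pow_le_pow_left₀ measureReal_nonneg (hGG b hb b' hb' hne) _)
  refine le_trans (le_of_eq ?_) key
  have hmap := map_curry_eq_pi hY hind hlaw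
  have hbad : MeasurableSet {ω : κ → ι → S | ∀ b ∈ T, ω ∉ E b} := by
    have : {ω : κ → ι → S | ∀ b ∈ T, ω ∉ E b} = ⋂ b ∈ T, (E b)ᶜ := by ext; simp
    rw [this]
    exact Finset.measurableSet_biInter _ fun b _ => (hEmeas b).compl
  rw [hL, hL0, ← hmap, map_measureReal_apply (by fun_prop) hbad]
  congr 1
  ext ω
  simp [hE, hG]

end Bins

/-! ### Separated families of caps -/

variable {d : ℕ}

/-- A maximal separated family of centres gives disjoint caps of size `t` whose enlargements by the
factor `4` cover the sphere, hence there are at least of the order of `t ^ (-d)` of them. -/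
theorem exists_disjoint_caps (hd : 1 ≤ d) {C : ℝ}
    (hC : ∀ (e : UnitSphere d) (t : ℝ), 0 < t →
      sphereUniform d (cap e t) ≤ ENNReal.ofReal (C * t ^ d))
    {t p : ℝ} (ht : 0 < t) (hp0 : 0 < p)
    (hp : ∀ e : UnitSphere d, (sphereUniform d).real (cap e t) = p) (hC0 : 0 < C) :
    ∃ T : Finset (UnitSphere d), (∀ e ∈ T, ∀ e' ∈ T, e ≠ e' → Disjoint (cap e t) (cap e' t)) ∧
      1 ≤ T.card * (C * (4 * t) ^ d) := by
  classical
  have := isProbabilityMeasure_sphereUniform hd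
  let Sep : Finset (UnitSphere d) → Prop := fun T => ∀ e ∈ T, ∀ e' ∈ T, e ≠ e' → e' ∉ cap e (4 * t)
  have hdis : ∀ T, Sep T → ∀ e ∈ T, ∀ e' ∈ T, e ≠ e' → Disjoint (cap e t) (cap e' t) := by
    intro T hT e he e' he' hne
    exact Set.disjoint_left.2 fun x hx hx' => hT e he e' he' hne (mem_cap_four_mul hx hx')
  have hcard : ∀ T, Sep T → (T.card : ℝ) ≤ 1 / p := by
    intro T hT
    rw [le_div_iff₀ hp0]
    have h1 : (sphereUniform d).real (⋃ e ∈ T, cap e t) = T.card * p := by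
      rw [measureReal_biUnion_finset (fun e he e' he' hne => hdis T hT e he e' he' hne)
        fun e _ => measurableSet_cap e t]
      simp [hp]
    rw [← h1]
    exact measureReal_le_one
  have hbdd : BddAbove {n : ℕ | ∃ T, Sep T ∧ T.card = n} := by
    refine ⟨⌊1 / p⌋₊, ?_⟩
    rintro n ⟨T, hT, rfl⟩
    exact Nat.le_floor (hcard T hT)
  obtain ⟨T, hT, hTc⟩ := Nat.sSup_mem (s := {n : ℕ | ∃ T, Sep T ∧ T.card = n})
    ⟨0, ∅, fun e he => absurd he (Finset.notMem_empty e), rfl⟩ hbdd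
  refine ⟨T, hdis T hT, ?_⟩
  have hcov : (Set.univ : Set (UnitSphere d)) ⊆ ⋃ e ∈ T, cap e (4 * t) := by
    intro x _
    by_contra hx
    simp only [Set.mem_iUnion, exists_prop, not_exists, not_and] at hx
    have hxT : x ∉ T := by
      intro hxT
      refine hx x hxT ?_
      show ‖1 - inner ℂ (x : EuclideanSpace ℂ (Fin d)) x‖ < 4 * t
      rw [inner_self_eq_norm_sq_to_K, mem_sphere_zero_iff_norm.1 x.2]
      simpa using ht
    have hins : Sep (insert x T) := by
      intro e he e' he' hne
      rcases Finset.mem_insert.1 he with rfl | he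
      · rcases Finset.mem_insert.1 he' with rfl | he'
        · exact absurd rfl hne
        · exact fun h => hx e' he' (mem_cap_comm.1 h)
      · rcases Finset.mem_insert.1 he' with h' | he'
        · rw [h']; exact hx e he
        · exact hT e he e' he' hne
    have := le_csSup hbdd ⟨_, hins, rfl⟩
    rw [← hTc, Finset.card_insert_of_notMem hxT] at this
    omega
  have h1 : (1 : ℝ≥0∞) ≤ ∑ e ∈ T, sphereUniform d (cap e (4 * t)) := by
    rw [← measure_univ (μ := sphereUniform d)]
    exact (measure_mono hcov).trans (measure_biUnion_finset_le _ _)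
  have h2 : (1 : ℝ≥0∞) ≤ ENNReal.ofReal (T.card * (C * (4 * t) ^ d)) := by
    refine h1.trans ((Finset.sum_le_sum fun e _ => hC e (4 * t) (by positivity)).trans ?_)
    rw [Finset.sum_const, nsmul_eq_mul, ENNReal.ofReal_mul (Nat.cast_nonneg _), ENNReal.ofReal_natCast]
  rwa [← ENNReal.ofReal_one, ENNReal.ofReal_le_ofReal_iff (by positivity)] at h2

/-- `1 - (1 - p) ^ n ≥ n p / (1 + n p)`, from Bernoulli's inequality. -/
theorem div_le_one_sub_one_sub_pow {p : ℝ} (hp0 : 0 ≤ p) (hp1 : p ≤ 1) (n : ℕ) :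
    n * p / (1 + n * p) ≤ 1 - (1 - p) ^ n := by
  have h0 : 0 < 1 + n * p := by positivity
  have h1 : 1 + n * p ≤ (1 + p) ^ n := one_add_mul_le_pow (by linarith) n
  have h2 : (1 - p) ^ n * (1 + p) ^ n ≤ 1 := by
    rw [← mul_pow]
    exact pow_le_one₀ (by nlinarith) (by nlinarith)
  have h3 : (1 - p) ^ n * (1 + n * p) ≤ 1 :=
    (mul_le_mul_of_nonneg_left h1 (pow_nonneg (by linarith) n)).trans h2
  rw [div_le_iff₀ h0]
  linarith

end Bins

section Clusters

/-! ### Clusters in overcrowded shells -/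

variable {Ω : Type*} [MeasurableSpace Ω] {P : Measure Ω} [IsProbabilityMeasure P] {d : ℕ}
  {r : ℕ → Set.Ioo (0 : ℝ) 1} {ξ : ℕ → Ω → UnitSphere d}

/-- A set of at least `K * n` indices contains `K` disjoint groups of `n` indices. -/
theorem exists_groups {S : Set ℕ} {K n : ℕ} (h : ((K * n : ℕ) : ℕ∞) ≤ S.encard) :
    ∃ i : Fin K × Fin n → ℕ, Function.Injective i ∧ ∀ a, i a ∈ S := by
  obtain ⟨t, htS, ht⟩ := Set.exists_subset_encard_eq h
  have hfin : t.Finite := Set.finite_of_encard_eq_coe ht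
  have hcard : Fintype.card (Fin K × Fin n) = Fintype.card hfin.toFinset := by
    rw [hfin.encard_eq_coe_toFinset_card] at ht
    simp only [Fintype.card_prod, Fintype.card_fin, Fintype.card_coe]
    exact_mod_cast ht.symm
  let e := Fintype.equivOfCardEq hcard
  refine ⟨fun a => e a, fun a b hab => e.injective (Subtype.ext hab), fun a => htS ?_⟩
  exact hfin.mem_toFinset.1 (e a).2

/-- `K` points of a common shell that lie in a cap of the size of their distance to the sphere. -/
def HasCluster (r : ℕ → Set.Ioo (0 : ℝ) 1) (x : ℕ → UnitSphere d) (K : ℕ) : Prop :=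
  ∃ (m : ℕ) (e : UnitSphere d) (s : Finset ℕ), s.card = K ∧
    (∀ n ∈ s, ((2 : ℝ) ^ (m + 1))⁻¹ ≤ 1 - (r n : ℝ) ∧ 1 - (r n : ℝ) < ((2 : ℝ) ^ m)⁻¹) ∧
    ∀ n ∈ s, x n ∈ cap e ((2 : ℝ) ^ m)⁻¹

/-- If the growth condition fails, the probability that no cluster of `K` points occurs vanishes:
use the condition with `ε = 1 / K` and caps that are `J` times smaller than the shell. -/
theorem exists_measureReal_no_cluster_le (hd : 1 ≤ d) (hmeas : ∀ n, Measurable (ξ n))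
    (hunif : ∀ n, Measure.map (ξ n) P = sphereUniform d) (hindep : iIndepFun ξ P)
    (h : ¬ ShellGrowth d r) {K : ℕ} (hK : 1 ≤ K) :
    ∃ B : ℝ, ∀ J : ℕ, 1 ≤ J → P.real {ω | ¬ HasCluster r (fun n => ξ n ω) K} ≤ B / J := by
  have := isProbabilityMeasure_sphereUniform hd
  obtain ⟨c, C, hc, hC, hlow, hup⟩ := exists_sphereUniform_cap_bounds hd
  refine ⟨C * 4 ^ d * 2 ^ K, fun J hJ => ?_⟩
  have hK0 : (0 : ℝ) < K := by exact_mod_cast hK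
  have hJ1 : (1 : ℝ) ≤ J := by exact_mod_cast hJ
  have hJ0 : (0 : ℝ) < J := by linarith
  have hD : 0 < K * ((J : ℝ) ^ d / c + 1) := by positivity
  simp only [ShellGrowth, not_exists, not_and, not_forall, not_le] at h
  obtain ⟨m, hm⟩ := h (1 / K) (K * ((J : ℝ) ^ d / c + 1)) (by positivity) hD
  -- `x` is the growth rate of the shell, `y` compensates it to the number `W` of caps of the
  -- natural size, up to constants.
  set x : ℝ := (2 : ℝ) ^ ((d : ℝ) * (1 - 1 / K) * (m : ℝ)) with hx
  set y : ℝ := (2 : ℝ) ^ ((d : ℝ) * (1 / K) * (m : ℝ)) with hy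
  set W : ℝ := ((2 : ℝ) ^ m) ^ d with hW
  have hW0 : 0 < W := by positivity
  have hx0 : 0 < x := Real.rpow_pos_of_pos two_pos _
  have hy0 : 0 < y := Real.rpow_pos_of_pos two_pos _
  have hW' : W = (2 : ℝ) ^ ((d : ℝ) * m) := by
    rw [hW, ← pow_mul, ← Real.rpow_natCast, Nat.cast_mul, mul_comm (m : ℝ)]
  have hxy : x * y = W := by
    rw [hx, hy, hW', ← Real.rpow_add two_pos]
    congr 1; ring
  have hyK : y ^ K = W := by
    rw [hy, hW', ← Real.rpow_natCast, ← Real.rpow_mul two_pos.le]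
    congr 1; field_simp
  have h1K : 1 / (K : ℝ) ≤ 1 := by
    rw [div_le_one hK0]; exact_mod_cast hK
  have hx1 : 1 ≤ x := Real.one_le_rpow one_le_two (by
    have : 0 ≤ 1 - 1 / (K : ℝ) := by linarith
    positivity)
  have hy1 : 1 ≤ y := Real.one_le_rpow one_le_two (by positivity)
  set n : ℕ := ⌈x * ((J : ℝ) ^ d / c)⌉₊ with hn
  have hnlow : x * ((J : ℝ) ^ d / c) ≤ n := Nat.le_ceil _
  have hnup : (n : ℝ) ≤ x * ((J : ℝ) ^ d / c + 1) := by
    have := (Nat.ceil_lt_add_one (show 0 ≤ x * ((J : ℝ) ^ d / c) by positivity)).le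
    rw [← hn] at this
    linarith
  have hcount : ((K * n : ℕ) : ℕ∞) ≤ shellCount r m := by
    rw [← ENat.toENNReal_le]
    refine le_trans ?_ hm.le
    rw [ENat.toENNReal_coe, ← ENNReal.ofReal_natCast]
    refine ENNReal.ofReal_le_ofReal ?_
    push_cast
    rw [mul_assoc, mul_comm _ x]
    exact mul_le_mul_of_nonneg_left hnup hK0.le
  obtain ⟨i, hi, hiS⟩ := exists_groups hcount
  set t : ℝ := ((2 : ℝ) ^ m)⁻¹ / J with ht
  have ht0 : 0 < t := by positivity
  have htm : t ≤ ((2 : ℝ) ^ m)⁻¹ := div_le_self (by positivity) hJ1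
  have ht1 : t ≤ 1 := htm.trans (inv_le_one_of_one_le₀ (one_le_pow₀ one_le_two))
  have htd : t ^ d = 1 / (W * (J : ℝ) ^ d) := by
    rw [ht, div_pow, inv_pow, ← hW]; field_simp
  let e0 : UnitSphere d := ⟨EuclideanSpace.single ⟨0, hd⟩ 1, by simp⟩
  set p : ℝ := (sphereUniform d).real (cap e0 t) with hp
  have hpe : ∀ e : UnitSphere d, (sphereUniform d).real (cap e t) = p := fun e => by
    rw [hp, measureReal_def, measureReal_def, sphereUniform_cap_congr hd e e0]
  have hplow : c * t ^ d ≤ p :=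
    (ENNReal.ofReal_le_iff_le_toReal (measure_ne_top _ _)).1 (hlow e0 t ht0 ht1)
  have hp0 : 0 < p := lt_of_lt_of_le (by positivity) hplow
  have hp1 : p ≤ 1 := measureReal_le_one
  obtain ⟨T, hTdis, hTcard⟩ := exists_disjoint_caps hd hup ht0 hp0 hpe hC
  have hTne : T.Nonempty := by
    rw [Finset.nonempty_iff_ne_empty]
    rintro rfl
    norm_num at hTcard
  have hnp : 1 / y ≤ n * p := by
    calc 1 / y = x * ((J : ℝ) ^ d / c) * (c * t ^ d) := by
          rw [htd, ← hxy]; field_simp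
      _ ≤ n * p := mul_le_mul hnlow hplow (by positivity) (by positivity)
  have hq : 1 / (2 * y) ≤ 1 - (1 - p) ^ n := by
    refine le_trans ?_ (div_le_one_sub_one_sub_pow hp0.le hp1 n)
    have h1 : 1 ≤ n * p * y := (div_le_iff₀ hy0).1 hnp
    have h2 : 0 < 1 + n * p := by positivity
    rw [div_le_div_iff₀ (by positivity) h2]
    nlinarith
  have hq0 : 0 < 1 - (1 - p) ^ n := lt_of_lt_of_le (by positivity) hq
  have hbins := measureReal_no_full_bin_le (P := P) (Y := fun a => ξ (i a)) (fun a => hmeas _)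
    (hindep.precomp hi) (fun a => hunif _) (fun e => cap e t) (fun e => measurableSet_cap e t) T hTne
    hTdis (fun e _ => hpe e) (by rwa [Fintype.card_fin])
  rw [Fintype.card_fin, Fintype.card_fin] at hbins
  refine (measureReal_mono ?_).trans (hbins.trans ?_)
  · intro ω hω e he
    by_contra! hcon
    choose j hj using hcon
    refine hω ⟨m, e, Finset.univ.image fun k => i (k, j k), ?_, ?_, ?_⟩
    · rw [Finset.card_image_of_injective _ fun k k' hkk => (Prod.ext_iff.1 (hi hkk)).1]
      simp
    · intro n hn
      obtain ⟨k, -, rfl⟩ := Finset.mem_image.1 hn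
      exact hiS _
    · intro n hn
      obtain ⟨k, -, rfl⟩ := Finset.mem_image.1 hn
      exact lt_of_lt_of_le (hj k) htm
  · have hqK : 1 / (2 ^ K * W) ≤ (1 - (1 - p) ^ n) ^ K := by
      refine le_trans (le_of_eq ?_) (pow_le_pow_left₀ (by positivity) hq K)
      rw [div_pow, one_pow, mul_pow, hyK]
    have hTW : W * (J : ℝ) ^ d / (C * 4 ^ d) ≤ T.card := by
      rw [mul_pow, htd] at hTcard
      rw [div_le_iff₀ (by positivity)]
      have := mul_le_mul_of_nonneg_right hTcard (show 0 ≤ W * (J : ℝ) ^ d by positivity)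
      calc W * (J : ℝ) ^ d = 1 * (W * (J : ℝ) ^ d) := (one_mul _).symm
        _ ≤ _ := this
        _ = T.card * (C * 4 ^ d) := by field_simp
    have hJd : (J : ℝ) ≤ (J : ℝ) ^ d := le_self_pow₀ hJ1 (by omega)
    have hmul := mul_le_mul hTW hqK (by positivity) (by positivity)
    calc 1 / (T.card * (1 - (1 - p) ^ n) ^ K)
        ≤ 1 / (W * (J : ℝ) ^ d / (C * 4 ^ d) * (1 / (2 ^ K * W))) :=
          one_div_le_one_div_of_le (by positivity) hmul
      _ = C * 4 ^ d * 2 ^ K / (J : ℝ) ^ d := by field_simp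
      _ ≤ C * 4 ^ d * 2 ^ K / J := div_le_div_of_nonneg_left (by positivity) hJ0 hJd

/-- Without the growth condition the Carleson property almost surely fails. -/
theorem ae_not_isCarlesonSequence (hd : 1 ≤ d) (hmeas : ∀ n, Measurable (ξ n))
    (hunif : ∀ n, Measure.map (ξ n) P = sphereUniform d) (hindep : iIndepFun ξ P)
    (h : ¬ ShellGrowth d r) :
    ∀ᵐ ω ∂P, ¬ IsCarlesonSequence (HardySpace d) (fun n => polarPoint (r n) (ξ n ω)) := by
  have hnull : ∀ K : ℕ, 1 ≤ K → ∀ᵐ ω ∂P, HasCluster r (fun n => ξ n ω) K := by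
    intro K hK
    obtain ⟨B, hB⟩ := exists_measureReal_no_cluster_le hd hmeas hunif hindep h hK
    have hlim : Filter.Tendsto (fun J : ℕ => B / (J : ℝ)) Filter.atTop (nhds 0) :=
      tendsto_const_div_atTop_nhds_zero_nat B
    have hle : P.real {ω | ¬ HasCluster r (fun n => ξ n ω) K} ≤ 0 :=
      ge_of_tendsto hlim (Filter.eventually_atTop.2 ⟨1, hB⟩)
    exact (measureReal_eq_zero_iff (measure_ne_top _ _)).1 (le_antisymm hle measureReal_nonneg)
  have hall : ∀ᵐ ω ∂P, ∀ K : ℕ, 1 ≤ K → HasCluster r (fun n => ξ n ω) K := by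
    rw [ae_all_iff]
    intro K
    by_cases hK : 1 ≤ K
    · filter_upwards [hnull K hK] with ω hω _ using hω
    · exact ae_of_all _ fun ω h' => absurd h' hK
  filter_upwards [hall] with ω hω hcarl
  obtain ⟨C, hC⟩ := (isCarlesonSequence_iff _ fun n => kerFun_ne_zero _).1 hcarl
  obtain ⟨K, hK⟩ := exists_nat_gt ((C : ℝ) * 36 ^ d)
  have hK1 : 1 ≤ K := by
    have : (0 : ℝ) < K := lt_of_le_of_lt (by positivity) hK
    exact_mod_cast this
  obtain ⟨m, e, s, hs, hshell, hcap⟩ := hω K hK1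
  have := card_le_of_cluster hC m e s hshell hcap
  rw [hs] at this
  linarith

end Clusters

section Rows

/-! ### Summability from shell growth, and an integral of the kernel -/

theorem exists_dyadic {a : ℝ} (h0 : 0 < a) (h1 : a < 1) :
    ∃ m : ℕ, ((2 : ℝ) ^ (m + 1))⁻¹ ≤ a ∧ a < ((2 : ℝ) ^ m)⁻¹ := by
  have h : ∃ n : ℕ, ((2 : ℝ) ^ n)⁻¹ ≤ a := by
    obtain ⟨n, hn⟩ := exists_pow_lt_of_lt_one h0 (by norm_num : (1 / 2 : ℝ) < 1)
    exact ⟨n, by rw [← inv_pow, ← one_div]; exact hn.le⟩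
  classical
  have hspec := Nat.find_spec h
  have hmin : ∀ k < Nat.find h, ¬ ((2 : ℝ) ^ k)⁻¹ ≤ a := fun k hk => Nat.find_min h hk
  rcases hn : Nat.find h with _ | m
  · rw [hn] at hspec
    simp only [pow_zero, inv_one] at hspec
    linarith
  · rw [hn] at hspec hmin
    exact ⟨m, hspec, not_le.1 (hmin m (Nat.lt_succ_self m))⟩

/-- The growth condition makes `∑ (1 - rₙ) ^ s` converge for exponents `s < d` close to `d`. -/
theorem ShellGrowth.exists_summable {d : ℕ} (hd : 1 ≤ d) {r : ℕ → Set.Ioo (0 : ℝ) 1}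
    (h : ShellGrowth d r) :
    ∃ s : ℝ, 0 ≤ s ∧ s < d ∧ Summable fun n => (1 - (r n : ℝ)) ^ s := by
  obtain ⟨ε, C, hε, hC, hm⟩ := h
  have hd0 : (0 : ℝ) < d := by exact_mod_cast hd
  set δ : ℝ := min ε 1 with hδ
  have hδ0 : 0 < δ := lt_min hε one_pos
  have hδ1 : δ ≤ 1 := min_le_right _ _
  have hδε : δ ≤ ε := min_le_left _ _
  have ha : ∀ n, 0 < 1 - (r n : ℝ) := fun n => by linarith [(r n).2.2]
  refine ⟨d * (1 - δ / 2), mul_nonneg hd0.le (by linarith), by nlinarith, ?_⟩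
  set s : ℝ := d * (1 - δ / 2) with hs
  have hs0 : 0 ≤ s := mul_nonneg hd0.le (by linarith)
  set S : ℕ → Set ℕ := fun m =>
    {n : ℕ | ((2 : ℝ) ^ (m + 1))⁻¹ ≤ 1 - (r n : ℝ) ∧ 1 - (r n : ℝ) < ((2 : ℝ) ^ m)⁻¹} with hS
  set θ : ℝ := (2 : ℝ) ^ (-(d * (δ / 2))) with hθ
  have hθ0 : 0 < θ := Real.rpow_pos_of_pos two_pos _
  have hθ1 : θ < 1 := Real.rpow_lt_one_of_one_lt_of_neg one_lt_two (by
    have : 0 < d * (δ / 2) := by positivity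
    linarith)
  have hbound : ∑' n, ENNReal.ofReal ((1 - (r n : ℝ)) ^ s) ≤ ∑' m : ℕ, ENNReal.ofReal (C * θ ^ m) := by
    calc ∑' n, ENNReal.ofReal ((1 - (r n : ℝ)) ^ s)
        ≤ ∑' n, ∑' m, (S m).indicator (fun _ => ENNReal.ofReal ((((2 : ℝ) ^ m)⁻¹) ^ s)) n := by
          refine ENNReal.tsum_le_tsum fun n => ?_
          obtain ⟨m, h1, h2⟩ := exists_dyadic (ha n) (by linarith [(r n).2.1])
          refine le_trans ?_ (ENNReal.le_tsum m)
          rw [Set.indicator_of_mem (show n ∈ S m from ⟨h1, h2⟩)]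
          exact ENNReal.ofReal_le_ofReal (Real.rpow_le_rpow (ha n).le h2.le hs0)
      _ = ∑' m, ∑' n, (S m).indicator (fun _ => ENNReal.ofReal ((((2 : ℝ) ^ m)⁻¹) ^ s)) n :=
          ENNReal.tsum_comm
      _ ≤ ∑' m : ℕ, ENNReal.ofReal (C * θ ^ m) := by
          refine ENNReal.tsum_le_tsum fun m => ?_
          rw [← tsum_subtype, ENNReal.tsum_set_const]
          refine (mul_le_mul_left (hm m) _).trans ?_
          rw [← ENNReal.ofReal_mul (by positivity)]
          refine ENNReal.ofReal_le_ofReal ?_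
          rw [mul_assoc]
          refine mul_le_mul_of_nonneg_left ?_ hC.le
          have e1 : (((2 : ℝ) ^ m)⁻¹) ^ s = (2 : ℝ) ^ (-((m : ℝ) * s)) := by
            rw [← Real.rpow_natCast, ← Real.rpow_neg two_pos.le, ← Real.rpow_mul two_pos.le]
            congr 1; ring
          rw [e1, ← Real.rpow_add two_pos, hθ, ← Real.rpow_natCast, ← Real.rpow_mul two_pos.le]
          refine Real.rpow_le_rpow_of_exponent_le one_le_two ?_
          rw [hs]
          have : 0 ≤ d * (m : ℝ) * (ε - δ) := mul_nonneg (by positivity) (by linarith)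
          nlinarith
  have hfin : ∑' m : ℕ, ENNReal.ofReal (C * θ ^ m) ≠ ∞ :=
    ((summable_geometric_of_lt_one hθ0.le hθ1).mul_left C).tsum_ofReal_ne_top
  have hfin2 : ∑' n, ENNReal.ofReal ((1 - (r n : ℝ)) ^ s) ≠ ∞ := ne_top_of_le_ne_top hfin hbound
  have := ENNReal.summable_toReal hfin2
  refine this.congr fun n => ?_
  rw [ENNReal.toReal_ofReal (Real.rpow_nonneg (ha n).le _)]

variable {d : ℕ}

theorem measurable_polarDist (ρ : ℝ) :
    Measurable fun q : UnitSphere d × UnitSphere d => polarDist ρ q.1 q.2 := by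
  have : Continuous fun q : UnitSphere d × UnitSphere d => polarDist ρ q.1 q.2 := by
    unfold polarDist
    fun_prop
  exact this.measurable

/-- The integral of `|1 - ρ⟨x, e⟩| ^ (-d)` over the sphere grows at most like `(1 - ρ) ^ (-γ)`
for each `γ > 0`, since `|1 - ⟨x, e⟩| ^ (γ - d)` is integrable. -/
theorem exists_lintegral_polarDist_le (hd : 1 ≤ d) {γ : ℝ} (hγ : 0 < γ) (hγd : γ ≤ d) :
    ∃ C : ℝ, 0 < C ∧ ∀ (ρ : ℝ) (e : UnitSphere d), 0 ≤ ρ → ρ < 1 →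
      ∫⁻ x, ENNReal.ofReal (1 / polarDist ρ e x ^ d) ∂(sphereUniform d) ≤
        ENNReal.ofReal (C * (1 - ρ) ^ (-γ)) := by
  have := isProbabilityMeasure_sphereUniform hd
  obtain ⟨-, B, -, hB, -, hup⟩ := exists_sphereUniform_cap_bounds hd
  set q : ℝ := d - γ with hq
  have hq0 : 0 ≤ q := by linarith
  set θ : ℝ := (2 : ℝ) ^ (-γ) with hθ
  have hθ0 : 0 < θ := Real.rpow_pos_of_pos two_pos _
  have hθ1 : θ < 1 := Real.rpow_lt_one_of_one_lt_of_neg one_lt_two (by linarith)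
  have hsum := (summable_geometric_of_lt_one hθ0.le hθ1).mul_left (2 ^ q * (B * 2 ^ d))
  have hsum0 : 0 ≤ ∑' l : ℕ, 2 ^ q * (B * 2 ^ d) * θ ^ l := tsum_nonneg fun l => by positivity
  refine ⟨1 + ∑' l : ℕ, 2 ^ q * (B * 2 ^ d) * θ ^ l, by positivity, fun ρ e hρ hρ1 => ?_⟩
  have hpos : ∀ x, 0 < polarDist ρ e x := fun x =>
    lt_of_lt_of_le (by linarith) (one_sub_le_polarDist hρ e x)
  have hpt : ∀ x, ENNReal.ofReal (polarDist ρ e x ^ (-q)) ≤ 1 + ∑' l : ℕ,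
      (cap e (2 * ((2 : ℝ) ^ l)⁻¹)).indicator
        (fun _ => ENNReal.ofReal (((2 : ℝ) ^ (l + 1)) ^ q)) x := by
    intro x
    rcases le_or_gt 1 (polarDist ρ e x) with h1 | h1
    · refine le_trans ?_ le_self_add
      rw [← ENNReal.ofReal_one]
      exact ENNReal.ofReal_le_ofReal (Real.rpow_le_one_of_one_le_of_nonpos h1 (by linarith))
    · obtain ⟨l, hl1, hl2⟩ := exists_dyadic (hpos x) h1
      refine le_trans ?_ le_add_self
      refine le_trans ?_ (ENNReal.le_tsum l)
      rw [Set.indicator_of_mem]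
      · refine ENNReal.ofReal_le_ofReal ?_
        rw [Real.rpow_neg (hpos x).le, ← Real.inv_rpow (hpos x).le]
        exact Real.rpow_le_rpow (inv_nonneg.2 (hpos x).le)
          (inv_le_of_inv_le₀ (by positivity) hl1) hq0
      · have := norm_one_sub_inner_le hρ hρ1.le e x
        show ‖1 - inner ℂ (e : EuclideanSpace ℂ (Fin d)) x‖ < 2 * ((2 : ℝ) ^ l)⁻¹
        linarith
  have hint : ∫⁻ x, ENNReal.ofReal (polarDist ρ e x ^ (-q)) ∂(sphereUniform d) ≤
      ENNReal.ofReal (1 + ∑' l : ℕ, 2 ^ q * (B * 2 ^ d) * θ ^ l) := by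
    refine (lintegral_mono hpt).trans ?_
    rw [lintegral_add_left measurable_const, lintegral_const, measure_univ, one_mul,
      ENNReal.ofReal_add zero_le_one hsum0, ENNReal.ofReal_one,
      ENNReal.ofReal_tsum_of_nonneg (fun l => by positivity) hsum, lintegral_tsum fun l =>
      (measurable_const.indicator (measurableSet_cap e _)).aemeasurable]
    gcongr with l
    rw [lintegral_indicator_const (measurableSet_cap e _)]
    refine (mul_le_mul_right (hup e _ (by positivity)) _).trans (le_of_eq ?_)
    rw [← ENNReal.ofReal_mul (by positivity)]
    congr 1
    have e1 : ((2 : ℝ) ^ (l + 1)) ^ q = 2 ^ q * 2 ^ ((l : ℝ) * q) := by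
      rw [← Real.rpow_natCast, ← Real.rpow_mul two_pos.le, ← Real.rpow_add two_pos]
      congr 1; push_cast; ring
    have e2 : θ ^ l = 2 ^ ((l : ℝ) * q) * (((2 : ℝ) ^ l)⁻¹) ^ d := by
      rw [hθ, ← Real.rpow_natCast, ← Real.rpow_mul two_pos.le, inv_pow, ← pow_mul,
        ← Real.rpow_natCast, ← Real.rpow_neg two_pos.le, ← Real.rpow_add two_pos]
      congr 1; push_cast; rw [hq]; ring
    rw [e1, e2, mul_pow]
    ring
  have hpt2 : ∀ x, ENNReal.ofReal (1 / polarDist ρ e x ^ d) ≤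
      ENNReal.ofReal ((1 - ρ) ^ (-γ)) * ENNReal.ofReal (polarDist ρ e x ^ (-q)) := by
    intro x
    rw [← ENNReal.ofReal_mul (Real.rpow_nonneg (by linarith) _)]
    refine ENNReal.ofReal_le_ofReal ?_
    have e1 : 1 / polarDist ρ e x ^ d = polarDist ρ e x ^ (-γ) * polarDist ρ e x ^ (-q) := by
      rw [← Real.rpow_add (hpos x), one_div, ← Real.rpow_natCast, ← Real.rpow_neg (hpos x).le]
      congr 1; rw [hq]; ring
    rw [e1]
    refine mul_le_mul_of_nonneg_right ?_ (Real.rpow_nonneg (hpos x).le _)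
    exact Real.rpow_le_rpow_of_nonpos (by linarith) (one_sub_le_polarDist hρ e x) (by linarith)
  calc ∫⁻ x, ENNReal.ofReal (1 / polarDist ρ e x ^ d) ∂(sphereUniform d)
      ≤ ∫⁻ x, ENNReal.ofReal ((1 - ρ) ^ (-γ)) * ENNReal.ofReal (polarDist ρ e x ^ (-q))
        ∂(sphereUniform d) := lintegral_mono hpt2
    _ = ENNReal.ofReal ((1 - ρ) ^ (-γ)) *
        ∫⁻ x, ENNReal.ofReal (polarDist ρ e x ^ (-q)) ∂(sphereUniform d) := by
        rw [lintegral_const_mul' _ _ ENNReal.ofReal_ne_top]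
    _ ≤ ENNReal.ofReal ((1 - ρ) ^ (-γ)) *
        ENNReal.ofReal (1 + ∑' l : ℕ, 2 ^ q * (B * 2 ^ d) * θ ^ l) := mul_le_mul_right hint _
    _ = _ := by
        rw [← ENNReal.ofReal_mul (Real.rpow_nonneg (by linarith) _), mul_comm]

/-! ### Exponential moments of the rows of the Gram matrix -/

/-- A product of functions of pairs `(ξ i, ξ j)` with common first member can be integrated factor
by factor, conditionally on `ξ i`. -/
theorem lintegral_prod_pair_le {Ω S : Type*} [MeasurableSpace Ω] [MeasurableSpace S] {P : Measure Ω}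
    [IsProbabilityMeasure P] {ξ : ℕ → Ω → S} (hmeas : ∀ n, Measurable (ξ n)) {ν : Measure S}
    (hunif : ∀ n, Measure.map (ξ n) P = ν) (hindep : iIndepFun ξ P) {i : ℕ} {F : Finset ℕ}
    (hi : i ∉ F) (φ : ℕ → S × S → ℝ≥0∞) (hφ : ∀ j, Measurable (φ j)) (b : ℕ → ℝ≥0∞)
    (hb : ∀ j ∈ F, ∀ e, ∫⁻ x, φ j (e, x) ∂ν ≤ b j) :
    ∫⁻ ω, ∏ j ∈ F, φ j (ξ i ω, ξ j ω) ∂P ≤ ∏ j ∈ F, b j := by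
  have hν : IsProbabilityMeasure ν := hunif 0 ▸ Measure.isProbabilityMeasure_map (hmeas 0).aemeasurable
  have hind : IndepFun (ξ i) (fun ω (j : F) => ξ j ω) P :=
    (hindep.indepFun_finset {i} F (Finset.disjoint_singleton_left.2 hi) hmeas).comp
      (φ := fun f : ({i} : Finset ℕ) → S => f ⟨i, Finset.mem_singleton_self i⟩) (ψ := id)
      (by fun_prop) measurable_id
  have hmF : Measurable fun ω (j : F) => ξ j ω := measurable_pi_lambda _ fun j => hmeas j
  set Ψ : S × (F → S) → ℝ≥0∞ := fun q => ∏ j : F, φ j (q.1, q.2 j) with hΨ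
  have hΨm : Measurable Ψ := Finset.measurable_prod _ fun j _ => by
    have := hφ j
    fun_prop
  have h1 : ∀ ω, ∏ j ∈ F, φ j (ξ i ω, ξ j ω) = Ψ (ξ i ω, fun j : F => ξ j ω) := by
    intro ω
    rw [hΨ]
    exact (Finset.prod_coe_sort F fun j => φ j (ξ i ω, ξ j ω)).symm
  have hmap := (indepFun_iff_map_prod_eq_prod_map_map (hmeas i).aemeasurable hmF.aemeasurable).1 hind
  have : IsProbabilityMeasure (P.map fun ω (j : F) => ξ j ω) :=
    Measure.isProbabilityMeasure_map hmF.aemeasurable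
  calc ∫⁻ ω, ∏ j ∈ F, φ j (ξ i ω, ξ j ω) ∂P
      = ∫⁻ q, Ψ q ∂(P.map fun ω => (ξ i ω, fun j : F => ξ j ω)) := by
        rw [lintegral_map hΨm ((hmeas i).prodMk hmF)]
        exact lintegral_congr h1
    _ = ∫⁻ e, ∫⁻ f, Ψ (e, f) ∂(P.map fun ω (j : F) => ξ j ω) ∂ν := by
        rw [hmap, hunif, lintegral_prod _ hΨm.aemeasurable]
    _ ≤ ∫⁻ _e, ∏ j ∈ F, b j ∂ν := by
        refine lintegral_mono fun e => ?_
        have hφe : ∀ j, Measurable fun x => φ j (e, x) := fun j => (hφ j).comp (by fun_prop)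
        rw [lintegral_map (f := fun f => Ψ (e, f)) (hΨm.comp (by fun_prop)) hmF]
        have h2 : ∀ ω, Ψ (e, fun j : F => ξ j ω) = ∏ j ∈ F, φ j (e, ξ j ω) := fun ω =>
          Finset.prod_coe_sort F fun j => φ j (e, ξ j ω)
        simp only [h2]
        rw [lintegral_prod_eq_prod_lintegral_of_indepFun F (fun j ω => φ j (e, ξ j ω))
          (hindep.comp (fun j x => φ j (e, x)) hφe) fun j => (hφe j).comp (hmeas j)]
        refine Finset.prod_le_prod' fun j hj => ?_
        rw [← lintegral_map (hφe j) (hmeas j), hunif]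
        exact hb j hj e
    _ = ∏ j ∈ F, b j := by rw [lintegral_const, measure_univ, mul_one]

/-- The quantity `(1 - rᵢ) ^ (d - s) (1 - rⱼ) ^ s / |1 - ⟨zᵢ, zⱼ⟩| ^ d` for points with directions
`y` and `x`: up to a constant factor, the entry of the Gram matrix weighted for the Schur test. -/
noncomputable def schurTerm (r : ℕ → Set.Ioo (0 : ℝ) 1) (s : ℝ) (i j : ℕ) (y x : UnitSphere d) : ℝ :=
  (1 - (r i : ℝ)) ^ ((d : ℝ) - s) * (1 - (r j : ℝ)) ^ s / polarDist (r i * r j) y x ^ d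

section SchurTerm

variable {r : ℕ → Set.Ioo (0 : ℝ) 1} {s : ℝ}

theorem one_sub_pos_radius (r : ℕ → Set.Ioo (0 : ℝ) 1) (n : ℕ) : 0 < 1 - (r n : ℝ) := by
  linarith [(r n).2.2]

theorem mul_radius_nonneg (r : ℕ → Set.Ioo (0 : ℝ) 1) (i j : ℕ) : 0 ≤ (r i : ℝ) * r j :=
  mul_nonneg (r i).2.1.le (r j).2.1.le

theorem mul_radius_lt_one (r : ℕ → Set.Ioo (0 : ℝ) 1) (i j : ℕ) : (r i : ℝ) * r j < 1 := by
  nlinarith [(r i).2.1, (r i).2.2, (r j).2.1, (r j).2.2]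

theorem one_sub_left_le (r : ℕ → Set.Ioo (0 : ℝ) 1) (i j : ℕ) :
    1 - (r i : ℝ) ≤ 1 - (r i : ℝ) * r j := by
  nlinarith [(r i).2.1, (r j).2.2]

theorem one_sub_right_le (r : ℕ → Set.Ioo (0 : ℝ) 1) (i j : ℕ) :
    1 - (r j : ℝ) ≤ 1 - (r i : ℝ) * r j := by
  nlinarith [(r j).2.1, (r i).2.2]

theorem schurTerm_nonneg (i j : ℕ) (y x : UnitSphere d) : 0 ≤ schurTerm r s i j y x :=
  div_nonneg (mul_nonneg (Real.rpow_nonneg (one_sub_pos_radius r i).le _)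
    (Real.rpow_nonneg (one_sub_pos_radius r j).le _)) (pow_nonneg (norm_nonneg _) _)

theorem schurTerm_le_one (hs0 : 0 ≤ s) (hsd : s ≤ d) (i j : ℕ) (y x : UnitSphere d) :
    schurTerm r s i j y x ≤ 1 := by
  have hg := one_sub_le_polarDist (mul_radius_nonneg r i j) y x
  have hi := (one_sub_left_le r i j).trans hg
  have hj := (one_sub_right_le r i j).trans hg
  have hi0 := one_sub_pos_radius r i
  have hj0 := one_sub_pos_radius r j
  have hg0 : 0 < polarDist (r i * r j) y x := hi0.trans_le hi
  rw [schurTerm, div_le_one (pow_pos hg0 d)]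
  calc (1 - (r i : ℝ)) ^ ((d : ℝ) - s) * (1 - (r j : ℝ)) ^ s
      ≤ polarDist (r i * r j) y x ^ ((d : ℝ) - s) * polarDist (r i * r j) y x ^ s :=
        mul_le_mul (Real.rpow_le_rpow hi0.le hi (by linarith)) (Real.rpow_le_rpow hj0.le hj hs0)
          (Real.rpow_nonneg hj0.le _) (Real.rpow_nonneg hg0.le _)
    _ = polarDist (r i * r j) y x ^ d := by
        rw [← Real.rpow_add hg0, sub_add_cancel, Real.rpow_natCast]

/-- For a fixed row, the entries are dominated by a summable sequence. -/
theorem schurTerm_le_mul (i j : ℕ) (y x : UnitSphere d) :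
    schurTerm r s i j y x ≤ (1 - (r i : ℝ)) ^ (-s) * (1 - (r j : ℝ)) ^ s := by
  have hg := one_sub_le_polarDist (mul_radius_nonneg r i j) y x
  have hi := (one_sub_left_le r i j).trans hg
  have hi0 := one_sub_pos_radius r i
  have hj0 := one_sub_pos_radius r j
  have e1 : (1 - (r i : ℝ)) ^ (-s) = (1 - (r i : ℝ)) ^ ((d : ℝ) - s) / (1 - (r i : ℝ)) ^ d := by
    rw [← Real.rpow_natCast, ← Real.rpow_sub hi0]
    congr 1; ring
  rw [schurTerm, e1, div_mul_eq_mul_div]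
  exact div_le_div_of_nonneg_left (by positivity) (pow_pos hi0 d) (pow_le_pow_left₀ hi0.le hi d)

theorem measurable_schurTerm (i j : ℕ) :
    Measurable fun q : UnitSphere d × UnitSphere d => schurTerm r s i j q.1 q.2 :=
  measurable_const.div ((measurable_polarDist _).pow_const d)

/-- The exponential moment of an entry with base `1 + λ`, `λ = (1 - rᵢ) ^ (-(d - s) / 2)`. The
exponent `(d - s) / 2` splits the gain `(1 - rᵢ) ^ (d - s)` evenly between `λ` and the loss in the
integral of the kernel. -/
theorem exists_lintegral_rpow_schurTerm_le (hd : 1 ≤ d) (r : ℕ → Set.Ioo (0 : ℝ) 1)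
    (hs0 : 0 ≤ s) (hsd : s < d) :
    ∃ C : ℝ, 0 < C ∧ ∀ (i j : ℕ) (e : UnitSphere d),
      ∫⁻ x, ENNReal.ofReal ((1 + (1 - (r i : ℝ)) ^ (-(((d : ℝ) - s) / 2))) ^ schurTerm r s i j e x)
        ∂(sphereUniform d) ≤ ENNReal.ofReal (Real.exp (C * (1 - (r j : ℝ)) ^ s)) := by
  have := isProbabilityMeasure_sphereUniform hd
  set γ : ℝ := ((d : ℝ) - s) / 2 with hγ
  obtain ⟨C, hC, h⟩ := exists_lintegral_polarDist_le hd (γ := γ) (by linarith) (by linarith)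
  refine ⟨C, hC, fun i j e => ?_⟩
  have hi0 := one_sub_pos_radius r i
  have hj0 := one_sub_pos_radius r j
  set A : ℝ := 1 - (r i : ℝ) with hA
  set B : ℝ := 1 - (r j : ℝ) with hB
  set l : ℝ := A ^ (-γ) with hl
  have hl0 : 0 < l := Real.rpow_pos_of_pos hi0 _
  have hpt : ∀ x, ENNReal.ofReal ((1 + l) ^ schurTerm r s i j e x) ≤
      1 + ENNReal.ofReal (l * (A ^ ((d : ℝ) - s) * B ^ s)) *
        ENNReal.ofReal (1 / polarDist (r i * r j) e x ^ d) := by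
    intro x
    rw [← ENNReal.ofReal_mul (by positivity), ← ENNReal.ofReal_one,
      ← ENNReal.ofReal_add zero_le_one (by
        have : 0 ≤ polarDist (r i * r j) e x := norm_nonneg _
        positivity)]
    refine ENNReal.ofReal_le_ofReal ?_
    refine (rpow_one_add_le_one_add_mul_self (by linarith) (schurTerm_nonneg i j e x)
      (schurTerm_le_one hs0 hsd.le i j e x)).trans (le_of_eq ?_)
    rw [schurTerm]
    ring
  refine (lintegral_mono hpt).trans ?_
  rw [lintegral_add_left measurable_const, lintegral_const, measure_univ, mul_one,
    lintegral_const_mul' _ _ ENNReal.ofReal_ne_top]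
  have hρ := h (r i * r j) e (mul_radius_nonneg r i j) (mul_radius_lt_one r i j)
  have hle : (1 - (r i : ℝ) * r j) ^ (-γ) ≤ A ^ (-γ) :=
    Real.rpow_le_rpow_of_nonpos hi0 (one_sub_left_le r i j) (by rw [hγ]; linarith)
  have hρ2 := hρ.trans (ENNReal.ofReal_le_ofReal (mul_le_mul_of_nonneg_left hle hC.le))
  refine (add_le_add_right (mul_le_mul_right hρ2 _) _).trans ?_
  rw [← ENNReal.ofReal_mul (by positivity), ← ENNReal.ofReal_one,
    ← ENNReal.ofReal_add zero_le_one (by positivity)]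
  refine ENNReal.ofReal_le_ofReal ?_
  have e1 : l * (A ^ ((d : ℝ) - s) * B ^ s) * (C * A ^ (-γ)) = C * B ^ s := by
    have : A ^ (-γ) * A ^ ((d : ℝ) - s) * A ^ (-γ) = 1 := by
      rw [← Real.rpow_add hi0, ← Real.rpow_add hi0, ← Real.rpow_zero A]
      congr 1; rw [hγ]; ring
    calc l * (A ^ ((d : ℝ) - s) * B ^ s) * (C * A ^ (-γ))
        = (A ^ (-γ) * A ^ ((d : ℝ) - s) * A ^ (-γ)) * (C * B ^ s) := by rw [hl]; ring
      _ = C * B ^ s := by rw [this, one_mul]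
  rw [e1, add_comm]
  exact Real.add_one_le_exp _

end SchurTerm

/-! ### Almost sure boundedness of the rows -/

section Positive

variable {Ω : Type*} [MeasurableSpace Ω] {P : Measure Ω} [IsProbabilityMeasure P]
  {r : ℕ → Set.Ioo (0 : ℝ) 1} {ξ : ℕ → Ω → UnitSphere d} {s : ℝ}

/-- A Chernoff bound for the sum of a row of the weighted Gram matrix. -/
theorem exists_measure_row_le (hd : 1 ≤ d) (hmeas : ∀ n, Measurable (ξ n))
    (hunif : ∀ n, Measure.map (ξ n) P = sphereUniform d) (hindep : iIndepFun ξ P)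
    (hs0 : 0 ≤ s) (hsd : s < d) (hsum : Summable fun n => (1 - (r n : ℝ)) ^ s) :
    ∃ (K : ℕ) (D : ℝ), ∀ (i : ℕ) (F : Finset ℕ), i ∉ F →
      P {ω | (K : ℝ) ≤ ∑ j ∈ F, schurTerm r s i j (ξ i ω) (ξ j ω)} ≤
        ENNReal.ofReal (D * (1 - (r i : ℝ)) ^ s) := by
  obtain ⟨C, hC, hmom⟩ := exists_lintegral_rpow_schurTerm_le hd r hs0 hsd
  set γ : ℝ := ((d : ℝ) - s) / 2 with hγ
  have hγ0 : 0 < γ := by rw [hγ]; linarith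
  -- With this `K`, the bound `(1 + λ) ^ (-K)` of the Chernoff argument is at most `(1 - rᵢ) ^ s`.
  obtain ⟨K, hK⟩ := exists_nat_ge (s / γ)
  rw [div_le_iff₀ hγ0] at hK
  refine ⟨K, Real.exp (C * ∑' n, (1 - (r n : ℝ)) ^ s), fun i F hi => ?_⟩
  have hi0 := one_sub_pos_radius r i
  set A : ℝ := 1 - (r i : ℝ) with hA
  have hA1 : A ≤ 1 := by rw [hA]; linarith [(r i).2.1]
  set l : ℝ := A ^ (-γ) with hl
  have hl0 : 0 < l := Real.rpow_pos_of_pos hi0 _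
  have hprod := lintegral_prod_pair_le hmeas hunif hindep hi
    (fun j q => ENNReal.ofReal ((1 + l) ^ schurTerm r s i j q.1 q.2))
    (fun j => ENNReal.measurable_ofReal.comp
      (measurable_const.pow (measurable_schurTerm (r := r) (s := s) i j)))
    (fun j => ENNReal.ofReal (Real.exp (C * (1 - (r j : ℝ)) ^ s))) (fun j _ e => hmom i j e)
  have hleft : ∀ ω, ∏ j ∈ F, ENNReal.ofReal ((1 + l) ^ schurTerm r s i j (ξ i ω) (ξ j ω)) =
      ENNReal.ofReal ((1 + l) ^ ∑ j ∈ F, schurTerm r s i j (ξ i ω) (ξ j ω)) := by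
    intro ω
    rw [← ENNReal.ofReal_prod_of_nonneg (fun j _ => by positivity),
      Real.rpow_sum_of_pos (by linarith)]
  have hright : ∏ j ∈ F, ENNReal.ofReal (Real.exp (C * (1 - (r j : ℝ)) ^ s)) ≤
      ENNReal.ofReal (Real.exp (C * ∑' n, (1 - (r n : ℝ)) ^ s)) := by
    rw [← ENNReal.ofReal_prod_of_nonneg (fun j _ => (Real.exp_pos _).le), ← Real.exp_sum,
      ← Finset.mul_sum]
    refine ENNReal.ofReal_le_ofReal (Real.exp_le_exp.2 (mul_le_mul_of_nonneg_left ?_ hC.le))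
    exact hsum.sum_le_tsum F fun j _ => Real.rpow_nonneg (one_sub_pos_radius r j).le _
  simp only [hleft] at hprod
  have hmk := mul_meas_ge_le_lintegral₀ (μ := P)
    (f := fun ω => ENNReal.ofReal ((1 + l) ^ ∑ j ∈ F, schurTerm r s i j (ξ i ω) (ξ j ω))) (by
      have : Measurable fun ω => ∑ j ∈ F, schurTerm r s i j (ξ i ω) (ξ j ω) :=
        Finset.measurable_fun_sum _ fun j _ =>
          Measurable.comp (g := fun q : UnitSphere d × UnitSphere d => schurTerm r s i j q.1 q.2)
            (f := fun ω => (ξ i ω, ξ j ω)) (measurable_schurTerm i j) ((hmeas i).prodMk (hmeas j))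
      exact (ENNReal.measurable_ofReal.comp (measurable_const.pow this)).aemeasurable)
    (ENNReal.ofReal ((1 + l) ^ (K : ℝ)))
  have hsub : {ω | (K : ℝ) ≤ ∑ j ∈ F, schurTerm r s i j (ξ i ω) (ξ j ω)} ⊆
      {ω | ENNReal.ofReal ((1 + l) ^ (K : ℝ)) ≤
        ENNReal.ofReal ((1 + l) ^ ∑ j ∈ F, schurTerm r s i j (ξ i ω) (ξ j ω))} := by
    intro ω hω
    exact ENNReal.ofReal_le_ofReal (Real.rpow_le_rpow_of_exponent_le (by linarith) hω)
  have h1 : ENNReal.ofReal ((1 + l) ^ (K : ℝ)) *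
      P {ω | (K : ℝ) ≤ ∑ j ∈ F, schurTerm r s i j (ξ i ω) (ξ j ω)} ≤
      ENNReal.ofReal (Real.exp (C * ∑' n, (1 - (r n : ℝ)) ^ s)) :=
    (mul_le_mul_right (measure_mono hsub) _).trans (hmk.trans (hprod.trans hright))
  have hbig : A ^ (-s) ≤ (1 + l) ^ (K : ℝ) := by
    calc A ^ (-s) ≤ A ^ (-γ * K) :=
          Real.rpow_le_rpow_of_exponent_ge hi0 hA1 (by linarith)
      _ = l ^ (K : ℝ) := by rw [hl, ← Real.rpow_mul hi0.le]
      _ ≤ (1 + l) ^ (K : ℝ) := Real.rpow_le_rpow hl0.le (by linarith) (Nat.cast_nonneg K)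
  have h2 := (mul_le_mul_left (ENNReal.ofReal_le_ofReal hbig) _).trans h1
  have h3 := mul_le_mul_right h2 (ENNReal.ofReal (A ^ s))
  rw [← mul_assoc, ← ENNReal.ofReal_mul (by positivity), ← Real.rpow_add hi0, add_neg_cancel,
    Real.rpow_zero, ENNReal.ofReal_one, one_mul, ← ENNReal.ofReal_mul (by positivity)] at h3
  rwa [mul_comm (Real.exp _)]

/-- By the Borel-Cantelli lemma all but finitely many row sums are bounded by a constant; each of the
others is bounded by `schurTerm_le_mul`. -/
theorem ae_exists_row_bound (hd : 1 ≤ d) (hmeas : ∀ n, Measurable (ξ n))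
    (hunif : ∀ n, Measure.map (ξ n) P = sphereUniform d) (hindep : iIndepFun ξ P)
    (hs0 : 0 ≤ s) (hsd : s < d) (hsum : Summable fun n => (1 - (r n : ℝ)) ^ s) :
    ∀ᵐ ω ∂P, ∃ K : ℝ, 0 ≤ K ∧ ∀ (i : ℕ) (F : Finset ℕ),
      ∑ j ∈ F, schurTerm r s i j (ξ i ω) (ξ j ω) ≤ K := by
  obtain ⟨K, D, hrow⟩ := exists_measure_row_le hd hmeas hunif hindep hs0 hsd hsum
  set E : ℕ → ℕ → Set Ω := fun i n =>
    {ω | (K : ℝ) ≤ ∑ j ∈ (Finset.range n).erase i, schurTerm r s i j (ξ i ω) (ξ j ω)} with hE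
  have hmono : ∀ i, Monotone (E i) := by
    intro i n n' hn ω hω
    refine le_trans hω (Finset.sum_le_sum_of_subset_of_nonneg ?_ fun j _ _ => schurTerm_nonneg _ _ _ _)
    exact Finset.erase_subset_erase _ (Finset.range_mono hn)
  have hEi : ∀ i, P (⋃ n, E i n) ≤ ENNReal.ofReal (D * (1 - (r i : ℝ)) ^ s) := by
    intro i
    rw [(hmono i).measure_iUnion]
    exact iSup_le fun n => hrow i _ (Finset.notMem_erase i _)
  have hfin : ∑' i, P (⋃ n, E i n) ≠ ∞ :=
    ne_top_of_le_ne_top (hsum.mul_left D).tsum_ofReal_ne_top (ENNReal.tsum_le_tsum hEi)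
  filter_upwards [ae_eventually_notMem hfin] with ω hω
  obtain ⟨i0, hi0⟩ := Filter.eventually_atTop.1 hω
  set A : ℝ := ∑' n, (1 - (r n : ℝ)) ^ s with hA
  have hpow : ∀ (n : ℕ) (u : ℝ), 0 ≤ (1 - (r n : ℝ)) ^ u := fun n u =>
    Real.rpow_nonneg (one_sub_pos_radius r n).le _
  have hA0 : 0 ≤ A := tsum_nonneg fun n => hpow n s
  have hM0 : 0 ≤ ∑ i ∈ Finset.range i0, (1 - (r i : ℝ)) ^ (-s) * A :=
    Finset.sum_nonneg fun i _ => mul_nonneg (hpow i _) hA0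
  refine ⟨(K + 1) + ∑ i ∈ Finset.range i0, (1 - (r i : ℝ)) ^ (-s) * A, by positivity,
    fun i F => ?_⟩
  rcases le_or_gt i0 i with hi | hi
  · have hnot := hi0 i hi
    obtain ⟨n, hn⟩ := F.exists_nat_subset_range
    have hlt : ∑ j ∈ (Finset.range n).erase i, schurTerm r s i j (ξ i ω) (ξ j ω) < K := by
      by_contra! hcon
      exact hnot (Set.mem_iUnion.2 ⟨n, hcon⟩)
    have h1 : ∑ j ∈ F, schurTerm r s i j (ξ i ω) (ξ j ω) ≤
        ∑ j ∈ insert i ((Finset.range n).erase i), schurTerm r s i j (ξ i ω) (ξ j ω) := by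
      refine Finset.sum_le_sum_of_subset_of_nonneg ?_ fun j _ _ => schurTerm_nonneg _ _ _ _
      intro j hj
      rw [Finset.mem_insert, Finset.mem_erase]
      exact (eq_or_ne j i).imp_right fun hji => ⟨hji, hn hj⟩
    rw [Finset.sum_insert (Finset.notMem_erase i _)] at h1
    have h2 := schurTerm_le_one (r := r) hs0 hsd.le i i (ξ i ω) (ξ i ω)
    linarith
  · have h1 : ∑ j ∈ F, schurTerm r s i j (ξ i ω) (ξ j ω) ≤ (1 - (r i : ℝ)) ^ (-s) * A := by
      refine (Finset.sum_le_sum fun j _ => schurTerm_le_mul i j _ _).trans ?_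
      rw [← Finset.mul_sum]
      exact mul_le_mul_of_nonneg_left (hsum.sum_le_tsum F fun j _ => hpow j s) (hpow i _)
    have h2 : (1 - (r i : ℝ)) ^ (-s) * A ≤ ∑ i ∈ Finset.range i0, (1 - (r i : ℝ)) ^ (-s) * A :=
      Finset.single_le_sum (f := fun i => (1 - (r i : ℝ)) ^ (-s) * A)
        (fun i _ => mul_nonneg (hpow i _) hA0) (Finset.mem_range.2 hi)
    have hK0 : (0 : ℝ) ≤ K := Nat.cast_nonneg K
    linarith

/-- Under the growth condition the Carleson property almost surely holds. -/
theorem ae_isCarlesonSequence (hd : 1 ≤ d) (hmeas : ∀ n, Measurable (ξ n))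
    (hunif : ∀ n, Measure.map (ξ n) P = sphereUniform d) (hindep : iIndepFun ξ P)
    (h : ShellGrowth d r) :
    ∀ᵐ ω ∂P, IsCarlesonSequence (HardySpace d) (fun n => polarPoint (r n) (ξ n ω)) := by
  obtain ⟨s, hs0, hsd, hsum⟩ := h.exists_summable hd
  filter_upwards [ae_exists_row_bound hd hmeas hunif hindep hs0 hsd hsum] with ω hω
  obtain ⟨K, hK, hrow⟩ := hω
  exact isCarlesonSequence_of_schur hK hrow

end Positive

end Rows

end RandomCarleson

theorem theorem1p3 {Ω : Type*} [MeasurableSpace Ω] (P : Measure Ω) [IsProbabilityMeasure P]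
    (d : ℕ) (hd : 1 ≤ d) (r : ℕ → Set.Ioo (0 : ℝ) 1) (ξ : ℕ → Ω → RandomCarleson.UnitSphere d)
    (hmeas : ∀ n, Measurable (ξ n))
    (hunif : ∀ n, Measure.map (ξ n) P = RandomCarleson.sphereUniform d)
    (hindep : iIndepFun ξ P) :
    (RandomCarleson.ShellGrowth d r →
      ∀ᵐ ω ∂P, RandomCarleson.IsCarlesonSequence (RandomCarleson.HardySpace d)
        (fun n => RandomCarleson.polarPoint (r n) (ξ n ω))) ∧
    (¬ RandomCarleson.ShellGrowth d r →
      ∀ᵐ ω ∂P, ¬ RandomCarleson.IsCarlesonSequence (RandomCarleson.HardySpace d)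
        (fun n => RandomCarleson.polarPoint (r n) (ξ n ω))) := by
  exact ⟨RandomCarleson.ae_isCarlesonSequence hd hmeas hunif hindep,
    RandomCarleson.ae_not_isCarlesonSequence hd hmeas hunif hindep⟩
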